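/- Let $k$ be a finite field with $q$ elements; tensor products are over $k$. Let $A=k[t]$, where $t$ is the standard coordinate on $\mathbf{P}^1_k$, let $\infty\in\mathbf{P}^1_k$ be the pole of $t$ and $F=k(t)$. Let $X$ be a smooth projective geometrically connected curve over $k$ with a surjective $k$-morphism $X\to\mathbf{P}^1_k$, let $K$ be its function field, and let $Y\subset X$ be the inverse image of $\operatorname{Spec}A=\mathbf{P}^1_k\setminus\{\infty\}$. For $z\in X\setminus Y$ let $K_z$ be the completion of $K$ at $z$. Let $\mathcal{O}_X(\infty)$ be the pullback to $X$ of the sheaf $\mathcal{O}_{\mathbf{P}^1}(\infty)$ of functions on $\mathbf{P}^1_k$ with a pole of order at most $1$ at $\infty$. For a scheme $S$ over $\operatorname{Spec}A$ let $C_0(S)$ be the $k$-vector space $\Gamma(S,\mathcal{O}_S)$ with the $A$-module structure in which $t$ acts by $c\mapsto tc+c^q$ (the Carlitz module). Let $\exp x=x+e_1x^q+e_2x^{q^2}+\cdots\in F[[x]]$ be the Carlitz exponential, the unique power series of this form with $\exp(tx)=t\exp x+(\exp x)^q$; it converges on every $K_z$ with $z\in X\setminus Y$. Let $C$ be the sheaf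 of $A$-modules on $X$ given by $$C(U)=\Big\{(c,(\gamma_z)_z)\in C_0(U\cap Y)\times\prod_{z\in U\setminus Y}K_z \;\Big|\; \exp\gamma_z=c \text{ in } K_z \text{ for all } z\in U\setminus Y\Big\},$$ where $A$ acts on $K_z$ by multiplication. Then there is a short exact sequence of sheaves of $A$-modules on $X$ $$0\longrightarrow \mathcal{O}_X\otimes A\overset{\partial}{\longrightarrow}\mathcal{O}_X(\infty)\otimes A\longrightarrow C\longrightarrow 0,$$ where $\partial(f\otimes a)=f\otimes ta-(tf+f^q)\otimes a$. -/

import Mathlib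

open CategoryTheory AlgebraicGeometry TopologicalSpace Opposite
open scoped Polynomial TensorProduct

universe u

noncomputable section

theorem isDomain_of_principal_maximalIdeal {S : Type u} [CommRing S] [IsLocalRing S]
    [IsNoetherianRing S] (ϖ : S) (hϖ : IsLocalRing.maximalIdeal S = Ideal.span {ϖ})
    (hreg : ϖ = 0 ∨ ϖ ∈ nonZeroDivisors S) : IsDomain S := by
  rcases hreg with h0 | hreg
  · have : IsField S := by
      rw [IsLocalRing.isField_iff_maximalIdeal_eq, hϖ, h0]; simp
    exact this.isDomain
  have key : ∀ a : S, a ≠ 0 → ∃ (n : ℕ) (u : Sˣ), a = u * ϖ ^ n := by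
    intro a ha
    have hK := Ideal.iInf_pow_eq_bot_of_isLocalRing (IsLocalRing.maximalIdeal S)
      (IsLocalRing.maximalIdeal.isMaximal S).ne_top
    have : ∃ n, a ∉ IsLocalRing.maximalIdeal S ^ n := by
      by_contra! h
      exact ha (by simpa [hK] using (Submodule.mem_iInf _).mpr h)
    classical
    obtain ⟨n, hn, hmin⟩ : ∃ n, a ∉ IsLocalRing.maximalIdeal S ^ n ∧
        ∀ m < n, a ∈ IsLocalRing.maximalIdeal S ^ m :=
      ⟨Nat.find this, Nat.find_spec this, fun m hm => by
        simpa using Nat.find_min this hm⟩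
    obtain _ | n := n
    · simp at hn
    have h1 := hmin n (Nat.lt_succ_self n)
    rw [hϖ, Ideal.span_singleton_pow, Ideal.mem_span_singleton'] at h1
    obtain ⟨b, hb⟩ := h1
    have hbu : IsUnit b := by
      by_contra hb'
      have : b ∈ IsLocalRing.maximalIdeal S := hb'
      apply hn
      rw [← hb, pow_succ']
      refine Ideal.mul_mem_mul this (Ideal.pow_mem_pow ?_ n)
      rw [hϖ]; exact Ideal.mem_span_singleton_self ϖ
    exact ⟨n, hbu.unit, hb.symm⟩
  have : NoZeroDivisors S := by
    constructor
    intro a b hab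
    by_contra! h
    obtain ⟨n, u, rfl⟩ := key a h.1
    obtain ⟨m, v, rfl⟩ := key b h.2
    have h2 : ϖ ^ (n + m) = 0 := by
      have : (↑(u * v) : S) * ϖ ^ (n + m) = 0 := by rw [← hab]; push_cast; ring
      exact (Units.mul_right_eq_zero _).mp this
    have := pow_mem hreg (n + m)
    rw [h2] at this
    exact zero_notMem_nonZeroDivisors this
  exact NoZeroDivisors.to_isDomain S

open IsLocalRing in
/-- The localization at a prime of an étale algebra over `k[x]` is a Dedekind domain
(a field or a discrete valuation ring). -/
theorem isDedekindDomain_of_etale_polynomial {k S L : Type u} [Field k] [CommRing S]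
    (g : MvPolynomial (Fin 1) k →+* S) (hg : g.Etale) (p : Ideal S) [p.IsPrime]
    [CommRing L] [Algebra S L] [IsLocalization.AtPrime L p] : IsDedekindDomain L := by
  algebraize [g, (algebraMap S L).comp g]
  let R := MvPolynomial (Fin 1) k
  have : IsPrincipalIdealRing R :=
    IsPrincipalIdealRing.of_surjective (MvPolynomial.uniqueAlgEquiv k (Fin 1)).symm.toRingHom
      (AlgEquiv.surjective _)
  let p' : Ideal R := p.under R
  let Rp := Localization.AtPrime p'
  have : IsPrincipalIdealRing Rp := IsPrincipalIdealRing.of_isNoetherianRing_of_isBezout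
  have : IsLocalRing L := IsLocalization.AtPrime.isLocalRing L p
  have : IsNoetherianRing S := Algebra.FiniteType.isNoetherianRing R S
  have : IsNoetherianRing L := IsLocalization.isNoetherianRing p.primeCompl L inferInstance
  let φ : Rp →+* L := IsLocalization.lift (M := p'.primeCompl) (g := algebraMap R L) (by
    rintro ⟨y, hy⟩
    rw [IsScalarTower.algebraMap_apply R S L]
    exact IsLocalization.map_units L (⟨algebraMap R S y, hy⟩ : p.primeCompl))
  algebraize [φ]
  have : IsScalarTower R Rp L := .of_algebraMap_eq fun x => by
    simp [RingHom.algebraMap_toAlgebra, φ]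
  have : IsLocalHom (algebraMap Rp L) := by
    constructor
    intro a ha
    obtain ⟨x, y, rfl⟩ := IsLocalization.exists_mk'_eq p'.primeCompl a
    rw [IsLocalization.AtPrime.isUnit_mk'_iff Rp p']
    intro hx
    have hx' : algebraMap R L x ∈ maximalIdeal L := by
      rw [IsScalarTower.algebraMap_apply R S L]
      exact (IsLocalization.AtPrime.to_map_mem_maximal_iff L p _).mpr hx
    apply hx'
    rw [IsScalarTower.algebraMap_apply R Rp L, ← IsLocalization.mk'_spec Rp x y, map_mul]
    refine ha.mul ?_
    exact (IsLocalization.map_units Rp y).map _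
  have : Algebra.FormallyEtale S L := .of_isLocalization p.primeCompl
  have : Algebra.FormallyEtale R L := .comp R S L
  have : Algebra.FormallyUnramified Rp L := .of_restrictScalars R Rp L
  have : Algebra.EssFiniteType S L := .of_isLocalization L p.primeCompl
  have : Algebra.EssFiniteType R L := .comp R S L
  have : Algebra.EssFiniteType Rp L := .of_comp R Rp L
  have : Module.Flat S L := IsLocalization.flat L p.primeCompl
  have : Module.Flat R L := .trans R S L
  have : Module.Flat Rp L := (Module.flat_iff_of_isLocalization Rp p'.primeCompl L).mpr ‹_›
  obtain ⟨ϖ, hϖ⟩ := (IsPrincipalIdealRing.principal (maximalIdeal Rp)).principal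
  have hmax : maximalIdeal L = Ideal.span {algebraMap Rp L ϖ} := by
    rw [← Algebra.FormallyUnramified.map_maximalIdeal (R := Rp), hϖ]
    exact (Ideal.map_span _ _).trans (by simp)
  have hdom : IsDomain L := by
    refine isDomain_of_principal_maximalIdeal _ hmax ?_
    by_cases h : ϖ = 0
    · simp [h]
    · right
      have h1 : IsSMulRegular L ϖ :=
        Module.Flat.isSMulRegular_of_nonZeroDivisors (mem_nonZeroDivisors_of_ne_zero h)
      rw [mem_nonZeroDivisors_iff_right]
      intro x hx
      apply h1
      simp [Algebra.smul_def, mul_comm, hx]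
  by_cases hf : IsField L
  · let := hf.toField
    infer_instance
  · have : (maximalIdeal L).IsPrincipal := ⟨⟨_, hmax⟩⟩
    have : IsDiscreteValuationRing L := ((IsDiscreteValuationRing.TFAE L hf).out 4 0).mp this
    infer_instance

/-- The local rings of a smooth curve over a field are Dedekind domains. -/
theorem isDedekindDomain_stalk_of_smooth {k : Type u} [Field k] {X : Scheme.{u}}
    (f : X ⟶ Spec (.of k)) [SmoothOfRelativeDimension 1 f] (x : X) :
    IsDedekindDomain (X.presheaf.stalk x) := by
  obtain ⟨U, hU, V, hV, hxV, e, hst⟩ :=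
    SmoothOfRelativeDimension.exists_isStandardSmoothOfRelativeDimension (n := 1) (f := f) x
  have hUne : U = ⊤ := by
    rw [eq_top_iff]
    intro y _
    have : y = f x := Subsingleton.elim _ _
    exact this ▸ e hxV
  have hfield : IsField Γ(Spec (.of k), U) := by
    subst hUne
    exact isField_of_isIntegral_of_subsingleton (Spec (.of k))
  let := hfield.toField
  obtain ⟨g, -, hg⟩ := hst.exists_etale_mvPolynomial
  let := TopCat.Presheaf.algebra_section_stalk X.presheaf ⟨x, hxV⟩
  have := hV.isLocalization_stalk ⟨x, hxV⟩
  exact isDedekindDomain_of_etale_polynomial g hg (hV.primeIdealOf ⟨x, hxV⟩).asIdeal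

/-- A smooth proper geometrically connected curve over a field is integral. -/
theorem isIntegral_of_smooth {k : Type u} [Field k] {X : Scheme.{u}}
    (f : X ⟶ Spec (.of k)) [SmoothOfRelativeDimension 1 f] [IsProper f]
    [GeometricallyConnected f] : IsIntegral X := by
  have := isDedekindDomain_stalk_of_smooth f
  have hconn : ConnectedSpace X := GeometricallyConnected.connectedSpace_of_subsingleton f
  have : IsReduced X := isReduced_of_isReduced_stalk X
  have : IsLocallyNoetherian X := LocallyOfFiniteType.isLocallyNoetherian f
  have : CompactSpace X := by
    exact QuasiCompact.compactSpace_of_compactSpace f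
  have : IsNoetherian X := {}
  have hfin : (irreducibleComponents X).Finite := TopologicalSpace.NoetherianSpace.finite_irreducibleComponents
  have huniq : ∀ Z ∈ irreducibleComponents X, ∀ Z' ∈ irreducibleComponents X,
      ∀ x, x ∈ Z → x ∈ Z' → Z = Z' := by
    intro Z hZ Z' hZ' x hx hx'
    have hW : IsIrreducible (closure (Set.range (X.fromSpecStalk x))) := by
      apply IsIrreducible.closure
      rw [← Set.image_univ]
      exact (IrreducibleSpace.isIrreducible_univ _).image _ (X.fromSpecStalk x).continuous.continuousOn
    have key : ∀ Z ∈ irreducibleComponents X, x ∈ Z →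
        Z = closure (Set.range (X.fromSpecStalk x)) := by
      intro Z hZ hx
      obtain ⟨η, hη⟩ := QuasiSober.sober hZ.1 (isClosed_of_mem_irreducibleComponents Z hZ)
      refine le_antisymm ?_ (hZ.2 hW ?_)
      all_goals
        rw [← hη.def]
        refine closure_mono ?_
        rw [Set.singleton_subset_iff, Scheme.range_fromSpecStalk]
        exact hη.specializes hx
    rw [key Z hZ hx, key Z' hZ' hx']
  have : IrreducibleSpace X := by
    obtain ⟨x⟩ := hconn.toNonempty
    let Z := irreducibleComponent x
    have hZ : Z ∈ irreducibleComponents X := irreducibleComponent_mem_irreducibleComponents x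
    have hclopen : IsClopen Z := by
      refine ⟨isClosed_irreducibleComponent, ?_⟩
      have : Z = (⋃₀ (irreducibleComponents X \ {Z}))ᶜ := by
        ext y
        simp only [Set.mem_compl_iff, Set.mem_sUnion, not_exists, not_and]
        constructor
        · rintro hy Z' ⟨hZ', hne⟩ hy'
          exact hne (huniq Z' hZ' Z hZ y hy' hy)
        · intro h
          by_contra hy
          exact h (irreducibleComponent y) ⟨irreducibleComponent_mem_irreducibleComponents y,
            fun h' => hy ((h' : _ = Z) ▸ mem_irreducibleComponent)⟩ mem_irreducibleComponent
      rw [this, isOpen_compl_iff]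
      rw [Set.sUnion_eq_biUnion]
      exact (hfin.subset Set.sdiff_subset).isClosed_biUnion
        fun Z' hZ' => isClosed_of_mem_irreducibleComponents Z' hZ'.1
    have huniv : Z = Set.univ := hclopen.eq_univ ⟨x, mem_irreducibleComponent⟩
    rw [irreducibleSpace_def, Set.top_eq_univ, ← huniv]
    exact isIrreducible_irreducibleComponent
  exact isIntegral_of_irreducibleSpace_of_isReduced X

instance P1.gradedAlgebra (k : Type u) [Field k] :
    GradedAlgebra (MvPolynomial.homogeneousSubmodule (Fin 2) k) :=
  MvPolynomial.gradedAlgebra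

/-- The projective line over `k`, with homogeneous coordinates `X 0` and `X 1`. -/
abbrev P1 (k : Type u) [Field k] : Scheme.{u} :=
  Proj (MvPolynomial.homogeneousSubmodule (Fin 2) k)

namespace P1

variable (k : Type u) [Field k]

/-- The structure morphism of the projective line. -/
def str : P1 k ⟶ Spec (.of k) :=
  Proj.toSpecZero _ ≫ Spec.map (CommRingCat.ofHom
    (algebraMap k (MvPolynomial.homogeneousSubmodule (Fin 2) k 0)))

/-- The open subset `Xᵢ ≠ 0`. The affine line `Spec k[t]` is `chart k 1`, and its
complement is the point `∞ = [1 : 0]`. -/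
def chart (i : Fin 2) : (P1 k).Opens := Proj.basicOpen _ (MvPolynomial.X i)

/-- The function `Xⱼ / Xᵢ` on the open subset `Xᵢ ≠ 0`. -/
def ratio (i j : Fin 2) : Γ(P1 k, chart k i) :=
  Proj.awayToSection _ _ (HomogeneousLocalization.Away.mk
    (MvPolynomial.homogeneousSubmodule (Fin 2) k) (f := MvPolynomial.X i) (d := 1)
    (MvPolynomial.isHomogeneous_X k i) 1 (MvPolynomial.X j)
    (by simpa using MvPolynomial.isHomogeneous_X k j))

/-- The standard coordinate `t = X₀ / X₁` on the affine line. -/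
def coord : Γ(P1 k, chart k 1) := ratio k 1 0

variable {k}

theorem mem_chart (x : Proj (MvPolynomial.homogeneousSubmodule (Fin 2) k)) : x ∈ chart k 0 ∨ x ∈ chart k 1 := by
  have := Proj.iSup_basicOpen_eq_top' (MvPolynomial.homogeneousSubmodule (Fin 2) k)
    (fun i : Fin 2 => MvPolynomial.X i) (fun i => ⟨1, MvPolynomial.isHomogeneous_X k i⟩) (by
      rw [eq_top_iff]
      intro p _
      induction p using MvPolynomial.induction_on with
      | C a =>
        exact Subalgebra.algebraMap_mem _
          (⟨MvPolynomial.C a, MvPolynomial.isHomogeneous_C _ a⟩ :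
            MvPolynomial.homogeneousSubmodule (Fin 2) k 0)
      | add p q hp hq => exact add_mem (hp trivial) (hq trivial)
      | mul_X p i hp => exact mul_mem (hp trivial) (Algebra.subset_adjoin ⟨i, rfl⟩))
  have hx : x ∈ (⊤ : (P1 k).Opens) := trivial
  rw [← this, Opens.mem_iSup] at hx
  obtain ⟨i, hi⟩ := hx
  fin_cases i
  · exact .inl hi
  · exact .inr hi

/-- The homogeneous prime ideal of a point of the projective line. -/
def primeAt (x : P1 k) : Ideal (MvPolynomial (Fin 2) k) :=
  HomogeneousIdeal.toIdeal (ProjectiveSpectrum.asHomogeneousIdeal x)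

instance (x : P1 k) : (primeAt x).IsPrime := ProjectiveSpectrum.isPrime x

/-- The local ring of a point of the projective line inside the localization of the
homogeneous coordinate ring. -/
def stalkVal (x : P1 k) : (P1 k).presheaf.stalk x →+* Localization.AtPrime (primeAt x) :=
  (algebraMap (HomogeneousLocalization.AtPrime (MvPolynomial.homogeneousSubmodule (Fin 2) k)
    (primeAt x)) (Localization.AtPrime (primeAt x))).comp
    (Proj.stalkIso' (MvPolynomial.homogeneousSubmodule (Fin 2) k) x).toRingHom

theorem stalkVal_injective (x : P1 k) : Function.Injective (stalkVal x) :=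
  (HomogeneousLocalization.val_injective _).comp
    (Proj.stalkIso' (MvPolynomial.homogeneousSubmodule (Fin 2) k) x).injective

theorem stalkVal_germ_ratio (x : P1 k) (i j : Fin 2) (hx : x ∈ chart k i) :
    stalkVal x ((P1 k).presheaf.germ (chart k i) x hx (ratio k i j)) =
      IsLocalization.mk' (M := (primeAt x).primeCompl) _ (MvPolynomial.X j)
        ⟨MvPolynomial.X i, hx⟩ := by
  have h := Proj.stalkIso'_germ (MvPolynomial.homogeneousSubmodule (Fin 2) k) (chart k i) x hx
    (ratio k i j)
  refine (congrArg HomogeneousLocalization.val h).trans ?_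
  have hx' : (MvPolynomial.X i : MvPolynomial (Fin 2) k) ^ 1 ∈ (primeAt x).primeCompl := by
    rwa [pow_one]
  change Localization.mk (MvPolynomial.X j : MvPolynomial (Fin 2) k)
    (⟨MvPolynomial.X i ^ 1, hx'⟩ : (primeAt x).primeCompl) = _
  rw [Localization.mk_eq_mk']
  congr 2
  exact pow_one _

theorem germ_ratio_mul (x : P1 k) (i j : Fin 2) (hi : x ∈ chart k i) (hj : x ∈ chart k j) :
    (P1 k).presheaf.germ (chart k i) x hi (ratio k i j) *
      (P1 k).presheaf.germ (chart k j) x hj (ratio k j i) = 1 := by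
  apply stalkVal_injective x
  rw [map_mul, map_one, stalkVal_germ_ratio, stalkVal_germ_ratio]
  exact IsLocalization.mk'_mul_mk'_eq_one (M := (primeAt x).primeCompl)
    ⟨MvPolynomial.X j, hj⟩ ⟨MvPolynomial.X i, hi⟩

theorem mem_chart_of_isUnit (x : P1 k) (i j : Fin 2) (hi : x ∈ chart k i)
    (h : IsUnit ((P1 k).presheaf.germ (chart k i) x hi (ratio k i j))) : x ∈ chart k j := by
  have h2 := h.map (stalkVal x)
  rw [stalkVal_germ_ratio] at h2
  exact (IsLocalization.AtPrime.isUnit_mk'_iff _ (primeAt x) _ _).mp h2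

end P1

theorem P1.chart_nonempty (k : Type u) [Field k] (i : Fin 2) : ∃ y : P1 k, y ∈ P1.chart k i := by
  have : Nontrivial (Localization.Away (MvPolynomial.X i : MvPolynomial (Fin 2) k)) :=
    (IsLocalization.injective (M := Submonoid.powers (MvPolynomial.X i : MvPolynomial (Fin 2) k)) _
      (powers_le_nonZeroDivisors_of_noZeroDivisors (MvPolynomial.X_ne_zero i))).nontrivial
  have : Nontrivial (HomogeneousLocalization.Away
      (MvPolynomial.homogeneousSubmodule (Fin 2) k) (MvPolynomial.X i)) :=
    ⟨⟨0, 1, fun h => zero_ne_one (α := Localization.Away (MvPolynomial.X i : MvPolynomial (Fin 2) k))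
      (by simpa using congrArg HomogeneousLocalization.val h)⟩⟩
  obtain ⟨y⟩ : Nonempty (Spec (.of (HomogeneousLocalization.Away
      (MvPolynomial.homogeneousSubmodule (Fin 2) k) (MvPolynomial.X i)))) :=
    inferInstanceAs (Nonempty (PrimeSpectrum _))
  have hX : (MvPolynomial.X i : MvPolynomial (Fin 2) k) ∈
    MvPolynomial.homogeneousSubmodule (Fin 2) k 1 := MvPolynomial.isHomogeneous_X k i
  have h : Proj.awayι _ _ hX one_pos y ∈ (Proj.awayι _ _ hX one_pos).opensRange := ⟨y, rfl⟩
  rw [Proj.opensRange_awayι] at h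
  exact ⟨_, h⟩

/-- A smooth proper geometrically connected curve over `k` together with a surjective
`k`-morphism to the projective line. (A smooth curve over a field is projective if and only
if it is proper.) -/
structure CurveOverP1 (k : Type u) [Field k] where
  /-- the curve -/
  X : Scheme.{u}
  /-- its structure morphism -/
  str : X ⟶ Spec (.of k)
  smooth : SmoothOfRelativeDimension 1 str
  proper : IsProper str
  geometricallyConnected : GeometricallyConnected str
  /-- the morphism to the projective line -/
  toP1 : X ⟶ P1 k
  toP1_str : toP1 ≫ P1.str k = str
  surjective : Surjective toP1

namespace CurveOverP1

variable {k : Type u} [Field k] (D : CurveOverP1 k)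

instance : IsIntegral D.X :=
  have := D.smooth
  have := D.proper
  have := D.geometricallyConnected
  isIntegral_of_smooth D.str

instance (x : D.X) : IsDedekindDomain (D.X.presheaf.stalk x) :=
  have := D.smooth
  isDedekindDomain_stalk_of_smooth D.str x

/-- The function field of the curve. -/
abbrev K : Type u := D.X.functionField

/-- The inverse image of the affine line. -/
def Y : D.X.Opens := D.toP1 ⁻¹ᵁ P1.chart k 1

/-- The coordinate `t`, as a regular function on `Y`. -/
def tY : Γ(D.X, D.Y) := D.toP1.app (P1.chart k 1) (P1.coord k)

/-- The set of points of the curve above `∞`. -/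
abbrev Infty : Type u := {z : D.X // z ∉ D.Y}

theorem generic_mem {U : D.X.Opens} {x : D.X} (hx : x ∈ U) : genericPoint D.X ∈ U :=
  ((genericPoint_spec D.X).specializes (Set.mem_univ x)).mem_open U.isOpen hx

theorem generic_mem_Y : genericPoint D.X ∈ D.Y := by
  have := D.surjective
  obtain ⟨y, hy⟩ := P1.chart_nonempty k 1
  obtain ⟨x, hx⟩ := D.toP1.surjective y
  exact D.generic_mem (x := x) (show D.toP1 x ∈ _ from hx ▸ hy)

theorem generic_mem_inf {U : D.X.Opens} {x : D.X} (hx : x ∈ U) : genericPoint D.X ∈ U ⊓ D.Y :=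
  ⟨D.generic_mem hx, D.generic_mem_Y⟩

/-- The germ at the generic point of a function on an open set. -/
def toK (U : D.X.Opens) (hU : genericPoint D.X ∈ U) : Γ(D.X, U) →+* D.K :=
  (D.X.presheaf.germ U (genericPoint D.X) hU).hom

/-- The coordinate `t`, as an element of the function field. -/
def t : D.K := D.toK D.Y D.generic_mem_Y D.tY

/-- The local parameter `1/t` at infinity. -/
theorem exists_inv_t (z : D.Infty) : ∃ s ∈ IsLocalRing.maximalIdeal (D.X.presheaf.stalk z.1),
    algebraMap _ D.K s * D.t = 1 := by
  have hz : D.toP1 z.1 ∈ P1.chart k 0 := (P1.mem_chart _).resolve_right z.2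
  refine ⟨D.toP1.stalkMap z.1 ((P1 k).presheaf.germ _ _ hz (P1.ratio k 0 1)), ?_, ?_⟩
  · intro h
    have := (isUnit_map_iff (D.toP1.stalkMap z.1).hom _).mp h
    exact z.2 (P1.mem_chart_of_isUnit _ 0 1 hz this)
  · have hη : genericPoint D.X ∈ D.toP1 ⁻¹ᵁ P1.chart k 0 := D.generic_mem (x := z.1) hz
    have h := congrArg (D.toP1.stalkMap (genericPoint D.X))
      (P1.germ_ratio_mul _ 0 1 hη D.generic_mem_Y)
    rw [map_mul, map_one] at h
    rw [← h]
    congr 1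
    · have : Nonempty (D.toP1 ⁻¹ᵁ P1.chart k 0) := ⟨⟨_, hη⟩⟩
      refine ((congrArg (algebraMap _ D.K) (Scheme.Hom.germ_stalkMap_apply D.toP1
        (P1.chart k 0) z.1 hz (P1.ratio k 0 1))).trans ?_).trans
        (Scheme.Hom.germ_stalkMap_apply D.toP1 (P1.chart k 0) _ hη (P1.ratio k 0 1)).symm
      exact Scheme.algebraMap_germ_eq_germToFunctionField (X := D.X)
        (U := D.toP1 ⁻¹ᵁ P1.chart k 0) (x := z.1) hz _
    · exact (Scheme.Hom.germ_stalkMap_apply D.toP1 (P1.chart k 1) _ D.generic_mem_Y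
        (P1.ratio k 1 0)).symm

/-- The place of the function field given by a point above `∞`. -/
def place (z : D.Infty) : IsDedekindDomain.HeightOneSpectrum (D.X.presheaf.stalk z.1) where
  asIdeal := IsLocalRing.maximalIdeal _
  isPrime := inferInstance
  ne_bot := by
    obtain ⟨s, hs, h⟩ := D.exists_inv_t z
    intro h0
    rw [h0, Ideal.mem_bot] at hs
    simp [hs] at h

/-- The completion of the function field at a point above `∞`. -/
abbrev Kz (z : D.Infty) : Type u := (D.place z).adicCompletion D.K

end CurveOverP1

section Carlitz

variable {k : Type u} [Field k] [Fintype k]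

/-- The action `c ↦ tc + c ^ q` of `t` on the Carlitz module, for an algebra over `k[t]`. -/
def carlitzMap {R : Type u} [CommRing R] [Algebra k R] (t : R) : R →ₗ[k] R :=
  LinearMap.mulLeft k t + (FiniteField.frobeniusAlgHom k R).toLinearMap

theorem carlitzMap_apply {R : Type u} [CommRing R] [Algebra k R] (t c : R) :
    carlitzMap (k := k) t c = t * c + c ^ Fintype.card k := rfl

/-- The Carlitz module of an algebra over `k` with a distinguished element `t`: the additive
group of the algebra, with `t` acting by `c ↦ tc + c ^ q`. -/
abbrev CarlitzModule (k : Type u) [Field k] [Fintype k] {R : Type u} [CommRing R] [Algebra k R]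
    (t : R) : Type u :=
  Module.AEval' (carlitzMap (k := k) t)

/-- A `k`-algebra with a distinguished element `t` as a module over `k[t]`, with `t` acting by
multiplication. -/
abbrev MulModule (k : Type u) [Field k] {R : Type u} [CommRing R] [Algebra k R] (t : R) : Type u :=
  Module.AEval' (LinearMap.mulLeft k t)

/-- The coefficients `e₀ = 1`, `e₁`, `e₂`, … of the Carlitz exponential
`exp x = ∑ᵢ eᵢ x ^ (q ^ i)`, as elements of a field containing `k(t)`. Comparing coefficients of
`x ^ (q ^ (i + 1))`, the functional equation `exp (tx) = t exp x + (exp x) ^ q` says exactly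
`(t ^ (q ^ (i + 1)) - t) e_{i+1} = eᵢ ^ q`. -/
def carlitzExpCoeff (q : ℕ) {L : Type u} [Field L] (t : L) : ℕ → L
  | 0 => 1
  | i + 1 => carlitzExpCoeff q t i ^ q / (t ^ q ^ (i + 1) - t)

/-- `exp γ = c` in a topological field containing `k[t]`. -/
def HasCarlitzExp (q : ℕ) {L : Type u} [Field L] [TopologicalSpace L] (t γ c : L) : Prop :=
  HasSum (fun i => carlitzExpCoeff q t i * γ ^ q ^ i) c

variable {L : Type u} [Field L] [Algebra k L]

theorem add_pow_card_pow {R : Type u} [CommRing R] [Algebra k R] (x y : R) (i : ℕ) :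
    (x + y) ^ Fintype.card k ^ i = x ^ Fintype.card k ^ i + y ^ Fintype.card k ^ i := by
  induction i with
  | zero => simp
  | succ i ih =>
    simp only [pow_succ, pow_mul, ih]
    exact map_add (FiniteField.frobeniusAlgHom k R) _ _

variable [TopologicalSpace L] [IsTopologicalRing L] {t : L}

theorem HasCarlitzExp.add {γ γ' c c' : L} (h : HasCarlitzExp (Fintype.card k) t γ c)
    (h' : HasCarlitzExp (Fintype.card k) t γ' c') :
    HasCarlitzExp (Fintype.card k) t (γ + γ') (c + c') := by
  have h2 := HasSum.add h h'
  simp only [← mul_add, ← add_pow_card_pow] at h2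
  exact h2

theorem HasCarlitzExp.smul {γ c : L} (a : k) (h : HasCarlitzExp (Fintype.card k) t γ c) :
    HasCarlitzExp (Fintype.card k) t (a • γ) (a • c) := by
  have h2 := HasSum.mul_left (algebraMap k L a) h
  rw [← Algebra.smul_def] at h2
  refine HasSum.congr_fun h2 fun i => ?_
  rw [smul_pow, FiniteField.pow_card_pow, Algebra.smul_def]
  ring

theorem HasCarlitzExp.mul {γ c : L} (ht : ∀ i, t ^ Fintype.card k ^ (i + 1) ≠ t)
    (h : HasCarlitzExp (Fintype.card k) t γ c) :
    HasCarlitzExp (Fintype.card k) t (t * γ) (carlitzMap (k := k) t c) := by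
  have h1 := HasSum.mul_left t h
  have h2 := HasSum.map h (FiniteField.frobeniusAlgHom k L) (continuous_pow (Fintype.card k))
  let b : ℕ → L := fun i => Nat.casesOn i 0 fun j =>
    (carlitzExpCoeff (Fintype.card k) t j * γ ^ Fintype.card k ^ j) ^ Fintype.card k
  have h3 : HasSum b (c ^ Fintype.card k) := by
    have := (hasSum_nat_add_iff (f := b) 1).mp h2
    simpa [b] using this
  refine HasSum.congr_fun (h1.add h3) fun i => ?_
  cases i with
  | zero => simp [b, carlitzExpCoeff]
  | succ i =>
    have hne : t ^ Fintype.card k ^ (i + 1) - t ≠ 0 := sub_ne_zero.mpr (ht i)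
    have he : carlitzExpCoeff (Fintype.card k) t (i + 1) * (t ^ Fintype.card k ^ (i + 1) - t) =
        carlitzExpCoeff (Fintype.card k) t i ^ Fintype.card k := by
      rw [carlitzExpCoeff, div_mul_cancel₀ _ hne]
    simp only [b]
    rw [mul_pow, mul_pow, ← he, ← pow_mul, ← pow_succ]
    ring

end Carlitz

/-- A `k`-linear map commuting with given endomorphisms, as a map of `k[t]`-modules. -/
def aevalMap {k M N : Type u} [Field k] [AddCommGroup M] [Module k M] [AddCommGroup N] [Module k N]
    (φ : M →ₗ[k] M) (ψ : N →ₗ[k] N) (f : M →ₗ[k] N) (h : ∀ m, f (φ m) = ψ (f m)) :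
    Module.AEval' φ →ₗ[k[X]] Module.AEval' ψ :=
  LinearMap.ofAEval φ ((Module.AEval'.of ψ).toLinearMap ∘ₗ f) fun m => by
    simp [Module.AEval.X_smul_of, h]

namespace CurveOverP1

variable {k : Type u} [Field k] (D : CurveOverP1 k)

/-- The constants in the ring of functions on an open set. -/
def scalars (U : D.X.Opens) : k →+* Γ(D.X, U) :=
  (D.str.appLE ⊤ U le_top).hom.comp (Scheme.ΓSpecIso (.of k)).inv.hom

instance (U : D.X.Opens) : Algebra k Γ(D.X, U) := (D.scalars U).toAlgebra

/-- Restriction of functions, as a map of `k`-algebras. -/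
def res {U V : D.X.Opens} (h : V ≤ U) : Γ(D.X, U) →ₐ[k] Γ(D.X, V) where
  __ := (D.X.presheaf.map (homOfLE h).op).hom
  commutes' a := by
    change (D.X.presheaf.map (homOfLE h).op) (D.str.appLE ⊤ U le_top _) = D.str.appLE ⊤ V le_top _
    rw [← Scheme.Hom.appLE_map D.str le_top (homOfLE h).op]
    rfl

theorem res_res {U V W : D.X.Opens} (h : V ≤ U) (h' : W ≤ V) (f : Γ(D.X, U)) :
    D.res h' (D.res h f) = D.res (h'.trans h) f :=
  TopCat.Presheaf.restrict_restrict (F := D.X.presheaf) h' h f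

theorem res_rfl {U : D.X.Opens} (f : Γ(D.X, U)) : D.res le_rfl f = f := by
  change D.X.presheaf.map (𝟙 _) f = f
  rw [D.X.presheaf.map_id]
  rfl

instance : Algebra k D.K :=
  ((D.toK ⊤ trivial).comp (D.scalars ⊤)).toAlgebra

theorem toK_res {U V : D.X.Opens} (h : V ≤ U) (hV : genericPoint D.X ∈ V) (f : Γ(D.X, U)) :
    D.toK V hV (D.res h f) = D.toK U (h hV) f :=
  TopCat.Presheaf.germ_res_apply D.X.presheaf (homOfLE h) _ hV f

theorem toK_algebraMap (U : D.X.Opens) (hU : genericPoint D.X ∈ U) (a : k) :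
    D.toK U hU (algebraMap k _ a) = algebraMap k D.K a := by
  rw [← (D.res (le_top : U ≤ ⊤)).commutes a, toK_res]
  rfl

/-- The function `t` on an open subset of `Y`. -/
def tOn (U : D.X.Opens) : Γ(D.X, U ⊓ D.Y) := D.res inf_le_right D.tY

/-- The element `t` of the completion at a point above `∞`. -/
def tz (z : D.Infty) : D.Kz z := algebraMap D.K (D.Kz z) D.t

/-- The expansion at a point `z` above `∞` of a function on `U ∩ Y`, where `z ∈ U`. -/
def expand (U : D.X.Opens) (z : D.Infty) (hz : z.1 ∈ U) : Γ(D.X, U ⊓ D.Y) →+* D.Kz z :=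
  (algebraMap D.K (D.Kz z)).comp (D.toK (U ⊓ D.Y) (D.generic_mem_inf hz))

theorem expand_res {U V : D.X.Opens} (h : V ≤ U) (z : D.Infty) (hz : z.1 ∈ V)
    (f : Γ(D.X, U ⊓ D.Y)) :
    D.expand V z hz (D.res (inf_le_inf_right _ h) f) = D.expand U z (h hz) f :=
  congrArg (algebraMap D.K (D.Kz z)) (D.toK_res _ _ f)

theorem expand_tOn (U : D.X.Opens) (z : D.Infty) (hz : z.1 ∈ U) :
    D.expand U z hz (D.tOn U) = D.tz z :=
  congrArg (algebraMap D.K (D.Kz z)) (D.toK_res _ _ D.tY)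

theorem expand_algebraMap (U : D.X.Opens) (z : D.Infty) (hz : z.1 ∈ U) (a : k) :
    D.expand U z hz (algebraMap k _ a) = algebraMap k (D.Kz z) a := by
  rw [IsScalarTower.algebraMap_apply k D.K (D.Kz z)]
  exact congrArg (algebraMap D.K (D.Kz z)) (D.toK_algebraMap _ _ a)

theorem t_pow_ne (z : D.Infty) (n : ℕ) (hn : 2 ≤ n) : D.tz z ^ n ≠ D.tz z := by
  intro h
  obtain ⟨s, hs, hst⟩ := D.exists_inv_t z
  rw [tz, ← map_pow] at h
  have h1 : D.t ^ n = D.t := (algebraMap D.K (D.Kz z)).injective h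
  obtain ⟨m, rfl⟩ := Nat.exists_eq_add_of_le hn
  have h2 : algebraMap (D.X.presheaf.stalk z.1) D.K (s ^ (1 + m)) = 1 := by
    have h3 : (algebraMap _ D.K s * D.t) ^ (2 + m) = algebraMap _ D.K s ^ (1 + m) := by
      rw [mul_pow, h1, show 2 + m = (1 + m) + 1 by ring, pow_succ, mul_assoc, hst, mul_one]
    rw [map_pow, ← h3, hst, one_pow]
  have h4 : s ^ (1 + m) = 1 :=
    IsFractionRing.injective (D.X.presheaf.stalk z.1) D.K (by rw [h2, map_one])
  exact hs (IsUnit.of_pow_eq_one h4 (by omega))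

variable [Fintype k]

/-- The Carlitz module `C₀(U ∩ Y)`. -/
abbrev C0 (U : D.X.Opens) : Type u := CarlitzModule k (D.tOn U)

/-- The points of `U` above `∞`. -/
abbrev InftyIn (U : D.X.Opens) : Type u := {z : D.Infty // z.1 ∈ U}

/-- The `A`-module `C₀(U ∩ Y) × ∏ K_z`, where `z` runs over the points of `U` above `∞`. -/
abbrev CAmbient (U : D.X.Opens) : Type u :=
  D.C0 U × ∀ z : D.InftyIn U, MulModule k (D.tz z.1)

/-- The condition `exp γ_z = c` for all points `z` of `U` above `∞`. -/
def IsCSection (U : D.X.Opens) (x : D.CAmbient U) : Prop :=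
  ∀ z : D.InftyIn U, HasCarlitzExp (Fintype.card k) (D.tz z.1)
    ((Module.AEval'.of _).symm (x.2 z)) (D.expand U z.1 z.2 ((Module.AEval'.of _).symm x.1))

theorem isCSection_X_smul {U : D.X.Opens} {x : D.CAmbient U} (hx : D.IsCSection U x) :
    D.IsCSection U ((Polynomial.X : k[X]) • x) := by
  intro z
  have h := (hx z).mul (k := k) fun i => D.t_pow_ne z.1 _ ((Fintype.one_lt_card).trans_le
    (Nat.le_self_pow (Nat.succ_ne_zero i) _))
  have h1 : (Module.AEval'.of _).symm (((Polynomial.X : k[X]) • x).2 z) =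
      D.tz z.1 * (Module.AEval'.of _).symm (x.2 z) := Module.AEval.of_symm_X_smul _ _
  have h2 : (Module.AEval'.of _).symm ((Polynomial.X : k[X]) • x).1 =
      carlitzMap (k := k) (D.tOn U) ((Module.AEval'.of _).symm x.1) :=
    Module.AEval.of_symm_X_smul _ _
  rw [h1, h2]
  convert h using 1
  rw [carlitzMap_apply, carlitzMap_apply, map_add, map_mul, map_pow, expand_tOn]

theorem isCSection_C_smul {U : D.X.Opens} {x : D.CAmbient U} (a : k) (hx : D.IsCSection U x) :
    D.IsCSection U ((Polynomial.C a : k[X]) • x) := by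
  intro z
  have h := (hx z).smul a
  have h1 : (Module.AEval'.of _).symm (((Polynomial.C a : k[X]) • x).2 z) =
      a • (Module.AEval'.of _).symm (x.2 z) :=
    congrArg (Module.AEval'.of _).symm (Module.AEval.C_smul _ a (x.2 z))
  have h2 : (Module.AEval'.of _).symm ((Polynomial.C a : k[X]) • x).1 =
      a • ((Module.AEval'.of _).symm x.1) :=
    congrArg (Module.AEval'.of _).symm (Module.AEval.C_smul _ a x.1)
  rw [h1, h2]
  convert h using 1
  rw [Algebra.smul_def, Algebra.smul_def, map_mul, expand_algebraMap]

theorem isCSection_add {U : D.X.Opens} {x y : D.CAmbient U} (hx : D.IsCSection U x)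
    (hy : D.IsCSection U y) : D.IsCSection U (x + y) := by
  intro z
  have h := (hx z).add (k := k) (hy z)
  rw [← map_add, ← map_add, ← map_add] at h
  exact h

theorem isCSection_zero (U : D.X.Opens) : D.IsCSection U 0 := by
  intro z
  have h : HasCarlitzExp (Fintype.card k) (D.tz z.1) 0 0 := by
    refine HasSum.congr_fun hasSum_zero fun i => ?_
    rw [zero_pow (pow_ne_zero _ Fintype.card_ne_zero), mul_zero]
  simpa using h

/-- The `A`-module `C(U)` of pairs `(c, (γ_z)_z)` with `exp γ_z = c` for all `z`. -/
def CSections (U : D.X.Opens) : Submodule k[X] (D.CAmbient U) where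
  carrier := {x | D.IsCSection U x}
  add_mem' hx hy := D.isCSection_add hx hy
  zero_mem' := D.isCSection_zero U
  smul_mem' p x hx := by
    induction p using Polynomial.induction_on with
    | C a => exact D.isCSection_C_smul a hx
    | add p q hp hq => rw [add_smul]; exact D.isCSection_add hp hq
    | monomial n a h =>
      rw [pow_succ', mul_left_comm, mul_smul]
      exact D.isCSection_X_smul h

/-- Restriction of sections of `C`. -/
def CRes {U V : D.X.Opens} (h : V ≤ U) : D.CSections U →ₗ[k[X]] D.CSections V :=
  LinearMap.restrict (LinearMap.prodMap
    (aevalMap _ _ (D.res (inf_le_inf_right _ h)).toLinearMap fun c => by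
      simp only [carlitzMap_apply, AlgHom.toLinearMap_apply, map_add, map_mul, map_pow]
      congr 2
      exact TopCat.Presheaf.restrict_restrict (F := D.X.presheaf) _ _ D.tY)
    (LinearMap.pi fun z => LinearMap.proj (⟨z.1, h z.2⟩ : D.InftyIn U)))
    fun x hx z => by
      have := hx ⟨z.1, h z.2⟩
      rw [← D.expand_res h z.1 z.2] at this
      exact this

theorem CRes_fst {U V : D.X.Opens} (h : V ≤ U) (x : D.CSections U) :
    (D.CRes h x).1.1 = D.res (inf_le_inf_right _ h) x.1.1 := rfl

theorem CRes_snd {U V : D.X.Opens} (h : V ≤ U) (x : D.CSections U) (z : D.InftyIn V) :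
    (D.CRes h x).1.2 z = x.1.2 ⟨z.1, h z.2⟩ := rfl

/-- The presheaf `C`. -/
def CPresheaf : TopCat.Presheaf (ModuleCat.{u} k[X]) D.X where
  obj U := ModuleCat.of k[X] (D.CSections U.unop)
  map i := ModuleCat.ofHom (D.CRes i.unop.le)
  map_id U := by
    refine ModuleCat.hom_ext (LinearMap.ext fun x => ?_)
    change D.CRes le_rfl x = x
    exact Subtype.ext (Prod.ext (D.res_rfl x.1.1) rfl)
  map_comp i j := by
    refine ModuleCat.hom_ext (LinearMap.ext fun x => ?_)
    change D.CRes (j.unop.le.trans i.unop.le) x = D.CRes j.unop.le (D.CRes i.unop.le x)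
    exact Subtype.ext (Prod.ext (D.res_res (inf_le_inf_right _ i.unop.le)
      (inf_le_inf_right _ j.unop.le) x.1.1).symm rfl)

theorem CPresheaf_isSheaf : D.CPresheaf.IsSheaf := by
  rw [TopCat.Presheaf.isSheaf_iff_isSheaf_comp (forget _)]
  refine TopCat.Presheaf.isSheaf_of_isSheafUniqueGluing_types _ ?_
  intro ι U s hs
  let s' : ∀ i, D.CSections (U i) := s
  have hs' : ∀ i j, D.CRes inf_le_left (s' i) = D.CRes inf_le_right (s' j) := hs
  have hO := (TopCat.Sheaf.existsUnique_gluing' D.X.sheaf (fun i => U i ⊓ D.Y)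
    (iSup U ⊓ D.Y) (fun i => homOfLE (inf_le_inf_right _ (le_iSup U i)))
    (by rw [iSup_inf_eq]) (fun i => (s' i).1.1) ?_)
  · obtain ⟨c, hc, hcu⟩ := hO
    have hc' : ∀ i, D.res (inf_le_inf_right _ (le_iSup U i)) c = (s' i).1.1 := hc
    have hmem : ∀ z : D.InftyIn (iSup U), ∃ i, z.1.1 ∈ U i := fun z => Opens.mem_iSup.mp z.2
    choose idx hidx using hmem
    let γ : ∀ z : D.InftyIn (iSup U), MulModule k (D.tz z.1) :=
      fun z => (s' (idx z)).1.2 ⟨z.1, hidx z⟩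
    have hγ : ∀ i (z : D.InftyIn (U i)), γ ⟨z.1, le_iSup U i z.2⟩ = (s' i).1.2 z := by
      intro i z
      have h := congrArg (fun x => x.1.2 ⟨z.1, ⟨hidx ⟨z.1, le_iSup U i z.2⟩, z.2⟩⟩)
        (hs' (idx ⟨z.1, le_iSup U i z.2⟩) i)
      exact h
    have hsec : D.IsCSection (iSup U) (c, γ) := by
      intro z
      have h := (s' (idx z)).2 ⟨z.1, hidx z⟩
      have h2 : D.expand (U (idx z)) z.1 (hidx z) (s' (idx z)).1.1 = D.expand (iSup U) z.1 z.2 c :=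
        (congrArg (D.expand (U (idx z)) z.1 (hidx z)) (hc' (idx z)).symm).trans
          (D.expand_res (le_iSup U (idx z)) z.1 (hidx z) c)
      exact (congrArg (HasCarlitzExp (Fintype.card k) (D.tz z.1) (γ z)) h2).mp h
    refine ⟨(⟨(c, γ), hsec⟩ : D.CSections (iSup U)), ?_, ?_⟩
    · intro i
      exact Subtype.ext (Prod.ext (hc' i) (funext fun z => hγ i z))
    · intro y hy
      let y' : D.CSections (iSup U) := y
      have hy' : ∀ i, D.CRes (le_iSup U i) y' = s' i := hy
      refine Subtype.ext (Prod.ext (hcu _ fun i => ?_) (funext fun z => ?_))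
      · exact congrArg (fun x => x.1.1) (hy' i)
      · exact congrArg (fun x => x.1.2 ⟨z.1, hidx z⟩) (hy' (idx z))
  · intro i j
    have hle : (U i ⊓ D.Y) ⊓ (U j ⊓ D.Y) ≤ (U i ⊓ U j) ⊓ D.Y :=
      le_inf (inf_le_inf inf_le_left inf_le_left) (inf_le_left.trans inf_le_right)
    have h := congrArg (D.res hle) (congrArg (fun x => x.1.1) (hs' i j))
    exact ((D.res_res (inf_le_inf_right _ inf_le_left) hle (s' i).1.1).symm.trans h).trans
      (D.res_res (inf_le_inf_right _ inf_le_right) hle (s' j).1.1)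

/-- The sheaf `C`. -/
def C : TopCat.Sheaf (ModuleCat.{u} k[X]) D.X := ⟨D.CPresheaf, D.CPresheaf_isSheaf⟩

end CurveOverP1

/-- Extension of scalars `M ↦ A ⊗ M` from `k` to `A = k[t]`. -/
def tensorA (k : Type u) [Field k] : ModuleCat.{u} k ⥤ ModuleCat.{u} k[X] where
  obj M := ModuleCat.of k[X] (k[X] ⊗[k] M)
  map f := ModuleCat.ofHom (f.hom.baseChange k[X])
  map_id M := by
    refine ModuleCat.hom_ext ?_
    simp
  map_comp f g := by
    refine ModuleCat.hom_ext ?_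
    simp [LinearMap.baseChange_comp]

namespace CurveOverP1

variable {k : Type u} [Field k] (D : CurveOverP1 k)

theorem toK_tOn (U : D.X.Opens) (hU : genericPoint D.X ∈ U ⊓ D.Y) : D.toK _ hU (D.tOn U) = D.t :=
  D.toK_res _ _ D.tY

theorem algebraMap_germ {U : D.X.Opens} {x : D.X} (hx : x ∈ U) (f : Γ(D.X, U)) :
    algebraMap (D.X.presheaf.stalk x) D.K (D.X.presheaf.germ U x hx f) =
      D.toK U (D.generic_mem hx) f := by
  have : Nonempty U := ⟨⟨x, hx⟩⟩
  exact Scheme.algebraMap_germ_eq_germToFunctionField (X := D.X) hx f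

/-- The sections over `U` of the sheaf `O_X(n∞)`, the pullback to the curve of the invertible
sheaf of functions on the projective line with a pole of order at most `n` at `∞`. The latter is
trivial on the affine line and generated by `t ^ n` near `∞`, so that sections of the pullback are
functions on `U ∩ Y` that lie in `t ^ n O_{X,z}` for every point `z` of `U` above `∞`. -/
def OInftySections (n : ℤ) (U : D.X.Opens) : Submodule k Γ(D.X, U ⊓ D.Y) where
  carrier := {f | ∀ z : D.InftyIn U, ∃ g : D.X.presheaf.stalk z.1.1,
    D.toK (U ⊓ D.Y) (D.generic_mem_inf z.2) f = D.t ^ n * algebraMap _ D.K g}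
  add_mem' {f f'} hf hf' z := by
    obtain ⟨g, hg⟩ := hf z
    obtain ⟨g', hg'⟩ := hf' z
    exact ⟨g + g', by rw [map_add, map_add, hg, hg', mul_add]⟩
  zero_mem' z := ⟨0, by simp⟩
  smul_mem' a f hf z := by
    obtain ⟨g, hg⟩ := hf z
    refine ⟨D.X.presheaf.germ U z.1.1 z.2 (algebraMap k _ a) * g, ?_⟩
    rw [Algebra.smul_def, map_mul, map_mul, hg, algebraMap_germ, toK_algebraMap, toK_algebraMap]
    ring

/-- Restriction of sections of `O_X(n∞)`. -/
def OInftyRes (n : ℤ) {U V : D.X.Opens} (h : V ≤ U) :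
    D.OInftySections n U →ₗ[k] D.OInftySections n V :=
  LinearMap.restrict (D.res (inf_le_inf_right _ h)).toLinearMap fun f hf z => by
    obtain ⟨g, hg⟩ := hf ⟨z.1, h z.2⟩
    exact ⟨g, (D.toK_res _ _ f).trans hg⟩

/-- The structure sheaf, as a presheaf of `k`-vector spaces. -/
def OX : TopCat.Presheaf (ModuleCat.{u} k) D.X where
  obj U := ModuleCat.of k Γ(D.X, U.unop)
  map i := ModuleCat.ofHom (D.res i.unop.le).toLinearMap
  map_id _ := ModuleCat.hom_ext (LinearMap.ext fun f => D.res_rfl f)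
  map_comp _ _ := ModuleCat.hom_ext (LinearMap.ext fun f => (D.res_res _ _ f).symm)

/-- The sheaf `O_X(n∞)`, as a presheaf of `k`-vector spaces. -/
def OXInfty (n : ℤ) : TopCat.Presheaf (ModuleCat.{u} k) D.X where
  obj U := ModuleCat.of k (D.OInftySections n U.unop)
  map i := ModuleCat.ofHom (D.OInftyRes n i.unop.le)
  map_id _ := ModuleCat.hom_ext (LinearMap.ext fun f => Subtype.ext (D.res_rfl f.1))
  map_comp i j := ModuleCat.hom_ext (LinearMap.ext fun f =>
    Subtype.ext (D.res_res (inf_le_inf_right _ i.unop.le) (inf_le_inf_right _ j.unop.le) f.1).symm)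

/-- The inclusion of `O_X` in `O_X(∞)`. -/
def incl (U : D.X.Opens) : Γ(D.X, U) →ₗ[k] D.OInftySections 1 U :=
  LinearMap.codRestrict _ (D.res inf_le_left).toLinearMap fun f z => by
    obtain ⟨s, -, hs⟩ := D.exists_inv_t z.1
    refine ⟨s * D.X.presheaf.germ U z.1.1 z.2 f, ?_⟩
    rw [map_mul, algebraMap_germ, zpow_one, ← mul_assoc, mul_comm D.t, hs, one_mul]
    exact D.toK_res _ _ f

variable [Fintype k]

/-- The map `f ↦ tf + f ^ q` from `O_X` to `O_X(∞)`. -/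
def carlitzO (U : D.X.Opens) : Γ(D.X, U) →ₗ[k] D.OInftySections 1 U :=
  LinearMap.codRestrict _ (carlitzMap (D.tOn U) ∘ₗ (D.res inf_le_left).toLinearMap) fun f z => by
    obtain ⟨s, -, hs⟩ := D.exists_inv_t z.1
    refine ⟨D.X.presheaf.germ U z.1.1 z.2 f +
      s * D.X.presheaf.germ U z.1.1 z.2 f ^ Fintype.card k, ?_⟩
    rw [LinearMap.comp_apply, carlitzMap_apply, map_add, map_mul, map_pow, toK_tOn,
      AlgHom.toLinearMap_apply, toK_res, map_add, map_mul, map_pow, algebraMap_germ, zpow_one,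
      mul_add, ← mul_assoc, mul_comm D.t (algebraMap _ _ s), hs, one_mul]

/-- The map `∂ : f ⊗ a ↦ f ⊗ ta - (tf + f ^ q) ⊗ a` on sections. -/
def boundarySections (U : D.X.Opens) :
    k[X] ⊗[k] Γ(D.X, U) →ₗ[k[X]] k[X] ⊗[k] D.OInftySections 1 U :=
  (Polynomial.X : k[X]) • (D.incl U).baseChange k[X] - (D.carlitzO U).baseChange k[X]

theorem boundarySections_tmul (U : D.X.Opens) (a : k[X]) (f : Γ(D.X, U)) :
    D.boundarySections U (a ⊗ₜ f) =
      (Polynomial.X * a) ⊗ₜ D.incl U f - a ⊗ₜ D.carlitzO U f := by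
  simp [boundarySections, TensorProduct.smul_tmul']

theorem boundarySections_res {U V : D.X.Opens} (h : V ≤ U) :
    D.boundarySections V ∘ₗ (D.res h).toLinearMap.baseChange k[X] =
      (D.OInftyRes 1 h).baseChange k[X] ∘ₗ D.boundarySections U := by
  refine TensorProduct.AlgebraTensorModule.ext fun a f => ?_
  have h1 : D.incl V (D.res h f) = D.OInftyRes 1 h (D.incl U f) :=
    Subtype.ext ((D.res_res h inf_le_left f).trans
      (D.res_res inf_le_left (inf_le_inf_right _ h) f).symm)
  have h2 : D.carlitzO V (D.res h f) = D.OInftyRes 1 h (D.carlitzO U f) := by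
    refine Subtype.ext ?_
    change carlitzMap (k := k) (D.tOn V) (D.res inf_le_left (D.res h f)) =
      D.res (inf_le_inf_right _ h) (carlitzMap (k := k) (D.tOn U) (D.res inf_le_left f))
    rw [carlitzMap_apply, carlitzMap_apply, map_add, map_mul, map_pow, tOn, tOn, res_res, res_res,
      res_res]
  rw [LinearMap.comp_apply, LinearMap.comp_apply, LinearMap.baseChange_tmul,
    boundarySections_tmul, boundarySections_tmul, map_sub, LinearMap.baseChange_tmul,
    LinearMap.baseChange_tmul, AlgHom.toLinearMap_apply, h1, h2]

/-- The map `∂` of presheaves. -/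
def boundaryPresheaf : D.OX ⋙ tensorA k ⟶ D.OXInfty 1 ⋙ tensorA k where
  app U := ModuleCat.ofHom (D.boundarySections U.unop)
  naturality _ _ i := ModuleCat.hom_ext (D.boundarySections_res i.unop.le)

/-- The sheaf of `A`-modules `F ⊗ A`: the sheaf associated to `U ↦ F(U) ⊗ A`. -/
abbrev sheafTensor (F : TopCat.Presheaf (ModuleCat.{u} k) D.X) :
    TopCat.Sheaf (ModuleCat.{u} k[X]) D.X :=
  (presheafToSheaf (Opens.grothendieckTopology D.X) (ModuleCat.{u} k[X])).obj (F ⋙ tensorA k)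

/-- The map `∂ : O_X ⊗ A ⟶ O_X(∞) ⊗ A` of sheaves of `A`-modules. -/
def boundary : D.sheafTensor D.OX ⟶ D.sheafTensor (D.OXInfty 1) :=
  (presheafToSheaf (Opens.grothendieckTopology D.X) (ModuleCat.{u} k[X])).map D.boundaryPresheaf

end CurveOverP1

end

noncomputable section

/-! At a point `z` above `∞` one has `|t| > 1`, and the coefficients of the Carlitz exponential
satisfy `|eᵢ| = |t| ^ (-i q ^ i)`. On the disc `|γ| ≤ |t|` the exponential is therefore the identity
up to a relative error `|t|⁻¹`, hence an isometric `k`-linear bijection of the disc onto itself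
(`valuation_eq`, `exists_log`). The sections of `O_X(∞)` are exactly the functions on `U ∩ Y` whose
expansions lie in these discs, so each such `f` has a logarithm at every `z`, and `f ↦ (f, log f)`
embeds `O_X(∞)` into `C`. Its `A`-linear extension is the map `O_X(∞) ⊗ A ⟶ C`. It kills `∂` because
a regular `f` has `|log f| ≤ 1`, so `t log f` stays in the disc and must equal `log (tf + f ^ q)`.
Injectivity of `∂` and exactness in the middle hold already for the presheaves, by looking at
leading coefficients in `A = k[t]`. If `∑ tⁱ log fᵢ = 0`, comparison of absolute values forces the
top `fᵢ` to be regular at infinity (`top_coeff_mem_range_incl`), and subtracting a value of `∂`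
lowers the degree. Surjectivity is only local (`exists_local_lift`). Near `z`, density of `K` in
`K_z` allows `γ_z` to be reduced by successive multiples `tⁿ log f` until it lies in the disc, where
every section of `C` has the form `(f, log f)`. Sheafification is exact and turns local surjectivity
into an epimorphism. -/

theorem Valuation.eq_zero_of_forall_le_pow {L Γ₀ : Type*} [Field L]
    [LinearOrderedCommGroupWithZero Γ₀] [MulArchimedean Γ₀] {v : Valuation L Γ₀} {s c x : L}
    (hs : v s < 1) (h : ∀ i, v x ≤ v (s ^ i * c)) : x = 0 := by
  by_contra hx
  have hx0 : v x ≠ 0 := (v.ne_zero_iff).mpr hx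
  have hc : c ≠ 0 := by
    rintro rfl
    exact hx0 (le_antisymm (by simpa using h 0) zero_le)
  have hc0 : v c ≠ 0 := (v.ne_zero_iff).mpr hc
  obtain ⟨n, hn⟩ := exists_pow_lt₀ hs (Units.mk0 (v x / v c) (div_ne_zero hx0 hc0))
  have := h n
  rw [map_mul, map_pow] at this
  rw [Units.val_mk0, lt_div_iff₀ (zero_lt_iff.mpr hc0)] at hn
  exact absurd this (not_le.mpr hn)

/-! ### Infinite sums in a complete valued field. -/

section ValuedSums

open Filter Topology

variable {L Γ₀ : Type*} [Field L] [LinearOrderedCommGroupWithZero Γ₀] [Valued L Γ₀]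

/-- The valuation is locally constant away from zero, so if `x ≠ 0` some finite partial sum has the
same value as `x`, and the ultrametric inequality applies to it. -/
theorem Valued.map_hasSum_le {ι : Type*} {f : ι → L} {x : L} {r : Γ₀} (h : HasSum f x)
    (hr : ∀ i, Valued.v (f i) ≤ r) : Valued.v x ≤ r := by
  by_contra! hlt
  have h0 : Valued.v x ≠ 0 := (zero_le.trans_lt hlt).ne'
  obtain ⟨s, hs⟩ := (h.eventually (Valued.locally_const h0)).exists
  have hs' : Valued.v (∑ i ∈ s, f i) = Valued.v x := hs
  exact absurd (Valuation.map_sum_le Valued.v fun i _ => hr i) (by rw [hs']; exact not_le.mpr hlt)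

theorem Valued.tendsto_zero_of_le {ι : Type*} {l : Filter ι} {f g : ι → L}
    (hg : Tendsto g l (𝓝 0)) (h : ∀ i, Valued.v (f i) ≤ Valued.v (g i)) :
    Tendsto f l (𝓝 0) := by
  rw [(Valued.hasBasis_nhds_zero L Γ₀).tendsto_right_iff] at hg ⊢
  intro γ hγ
  filter_upwards [hg γ hγ] with i hi
  exact ((Valued.v.restrict_le_iff).mpr (h i)).trans_lt hi

theorem Valued.nonarchimedeanAddGroup : NonarchimedeanAddGroup L where
  is_nonarchimedean U hU := by
    obtain ⟨γ, hγ⟩ := Valued.mem_nhds_zero.mp hU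
    exact ⟨⟨Valuation.ltAddSubgroup Valued.v.restrict γ, Valued.isOpen_ball L γ.1⟩, hγ⟩

theorem Valued.summable_of_le_geometric [MulArchimedean Γ₀] [CompleteSpace L] {f : ℕ → L} {s c : L}
    (hs : Valued.v s < 1) (h : ∀ i, Valued.v (f i) ≤ Valued.v (s ^ i * c)) : Summable f := by
  have : Tendsto f cofinite (𝓝 0) := by
    rw [Nat.cofinite_eq_atTop]
    refine Valued.tendsto_zero_of_le (g := fun i => s ^ i * c) ?_ h
    simpa using (Valued.tendsto_zero_pow_of_v_lt_one hs).mul_const c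
  have : NonarchimedeanAddGroup L := Valued.nonarchimedeanAddGroup
  exact NonarchimedeanAddGroup.summable_of_tendsto_cofinite_zero ‹_›

end ValuedSums

/-! ### The Carlitz exponential on the disc `|γ| ≤ |t|`. -/

namespace CarlitzExp

variable {k : Type u} [Field k] [Fintype k] {L : Type u} [Field L] [Algebra k L]
  {Γ₀ : Type*} [LinearOrderedCommGroupWithZero Γ₀] [Valued L Γ₀] {t : L}

theorem valuation_pow_sub (q : ℕ) (hq : 2 ≤ q) (ht : 1 < Valued.v t) (i : ℕ) :
    Valued.v (t ^ q ^ (i + 1) - t) = Valued.v t ^ q ^ (i + 1) := by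
  rw [← map_pow]
  refine Valuation.map_sub_eq_of_lt_left _ ?_
  rw [map_pow]
  have h : 1 < q ^ (i + 1) := Nat.one_lt_pow (Nat.succ_ne_zero i) hq
  simpa using pow_lt_pow_right₀ ht h

/-- The denominator in the recursion has value `|t| ^ q ^ (i + 1)`, so the exponents obey `a_{i+1} =
q aᵢ + q ^ (i + 1)`, solved by `aᵢ = i q ^ i`. The product form avoids negative powers. -/
theorem valuation_coeff (q : ℕ) (hq : 2 ≤ q) (ht : 1 < Valued.v t) (i : ℕ) :
    Valued.v (carlitzExpCoeff q t i) * Valued.v t ^ (i * q ^ i) = 1 := by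
  have ht0 : Valued.v t ≠ 0 := (zero_lt_one.trans ht).ne'
  induction i with
  | zero => simp [carlitzExpCoeff]
  | succ i ih =>
    rw [carlitzExpCoeff, map_div₀, valuation_pow_sub q hq ht, map_pow,
      show (i + 1) * q ^ (i + 1) = (i * q ^ i) * q + q ^ (i + 1) by ring,
      pow_add (Valued.v t), pow_mul (Valued.v t) (i * q ^ i), div_mul_eq_mul_div,
      ← mul_assoc, ← mul_pow, ih, one_pow, one_mul]
    exact div_self (pow_ne_zero _ ht0)

/-- Bound all but one of the `q ^ i` factors `|γ|` by `|t|`. What remains is the inequality of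
exponents `(q ^ i - 1) + i ≤ i q ^ i`. This geometric bound gives convergence and shows that the
linear term dominates. -/
theorem valuation_term_le (q : ℕ) (hq : 2 ≤ q) (ht : 1 < Valued.v t) {γ : L}
    (hγ : Valued.v γ ≤ Valued.v t) (i : ℕ) :
    Valued.v (carlitzExpCoeff q t i * γ ^ q ^ i) ≤ Valued.v (t⁻¹ ^ i * γ) := by
  have ht0 : 0 < Valued.v t := zero_lt_one.trans ht
  have h1 := valuation_coeff q hq ht i
  have hpos : 0 < Valued.v t ^ (i * q ^ i) := pow_pos ht0 _
  rw [map_mul, map_mul, map_pow, map_pow, map_inv₀, inv_pow, mul_comm (_)⁻¹, ← div_eq_mul_inv,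
    le_div_iff₀ (pow_pos ht0 i)]
  rw [← mul_le_mul_iff_left₀ hpos]
  have e1 : Valued.v (carlitzExpCoeff q t i) * Valued.v γ ^ q ^ i * Valued.v t ^ i *
      Valued.v t ^ (i * q ^ i) = Valued.v γ ^ q ^ i * Valued.v t ^ i := by
    rw [mul_assoc (Valued.v (carlitzExpCoeff q t i)), mul_right_comm, h1, one_mul]
  rw [e1]
  obtain ⟨m, hm⟩ : ∃ m, q ^ i = m + 1 := ⟨q ^ i - 1, by
    have : 0 < q ^ i := by positivity
    omega⟩
  have hmi : m + i ≤ i * q ^ i := by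
    rw [hm]
    rcases i with _ | i
    · simp at hm ⊢; omega
    · nlinarith [Nat.zero_le (i * m)]
  calc Valued.v γ ^ q ^ i * Valued.v t ^ i
      = Valued.v γ * (Valued.v γ ^ m * Valued.v t ^ i) := by rw [hm, pow_succ', mul_assoc]
    _ ≤ Valued.v γ * (Valued.v t ^ m * Valued.v t ^ i) := by gcongr
    _ = Valued.v γ * Valued.v t ^ (m + i) := by rw [pow_add]
    _ ≤ Valued.v γ * Valued.v t ^ (i * q ^ i) := by
        gcongr
        exact ht.le

theorem valuation_sub_le {q : ℕ} (hq : 2 ≤ q) (ht : 1 < Valued.v t) {γ c : L}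
    (hγ : Valued.v γ ≤ Valued.v t) (h : HasCarlitzExp q t γ c) :
    Valued.v (c - γ) ≤ Valued.v (t⁻¹ * γ) := by
  have h1 := (hasSum_nat_add_iff' 1).mpr h
  simp only [Finset.range_one, Finset.sum_singleton, carlitzExpCoeff, pow_zero, pow_one,
    one_mul] at h1
  refine Valued.map_hasSum_le h1 fun i => ?_
  refine (valuation_term_le q hq ht hγ (i + 1)).trans ?_
  rw [pow_succ, map_mul, map_mul, map_mul, mul_assoc]
  refine mul_le_of_le_one_left' ?_
  rw [map_pow, map_inv₀]
  exact pow_le_one₀ zero_le (inv_le_one_of_one_le₀ ht.le)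

theorem valuation_inv_lt_one (ht : 1 < Valued.v t) : Valued.v t⁻¹ < 1 := by
  rw [map_inv₀]
  exact inv_lt_one_of_one_lt₀ ht

theorem valuation_inv_mul_lt (ht : 1 < Valued.v t) {x : L} (hx : x ≠ 0) :
    Valued.v (t⁻¹ * x) < Valued.v x := by
  rw [map_mul]
  exact mul_lt_of_lt_one_left (zero_lt_iff.mpr ((Valuation.ne_zero_iff _).mpr hx))
    (valuation_inv_lt_one ht)

theorem valuation_inv_mul_le (ht : 1 < Valued.v t) (x : L) :
    Valued.v (t⁻¹ * x) ≤ Valued.v x := by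
  rcases eq_or_ne x 0 with rfl | hx
  · simp
  · exact (valuation_inv_mul_lt ht hx).le

/-- All terms after the first are strictly smaller than `γ`, so the exponential is isometric on the
disc. Being additive, it is then injective there. -/
theorem valuation_eq {q : ℕ} (hq : 2 ≤ q) (ht : 1 < Valued.v t) {γ c : L}
    (hγ : Valued.v γ ≤ Valued.v t) (h : HasCarlitzExp q t γ c) :
    Valued.v c = Valued.v γ := by
  have h1 := valuation_sub_le hq ht hγ h
  rcases eq_or_ne γ 0 with rfl | h0
  · rw [mul_zero, sub_zero, map_zero, le_zero_iff] at h1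
    rw [h1, map_zero]
  · exact Valuation.map_eq_of_sub_lt _ (h1.trans_lt (valuation_inv_mul_lt ht h0))

theorem sub {γ γ' c c' : L} (h : HasCarlitzExp (Fintype.card k) t γ c)
    (h' : HasCarlitzExp (Fintype.card k) t γ' c') :
    HasCarlitzExp (Fintype.card k) t (γ - γ') (c - c') := by
  simpa [sub_eq_add_neg] using h.add (k := k) (h'.smul (-1 : k))

variable (k) in
theorem eq_of_hasCarlitzExp (ht : 1 < Valued.v t) {γ γ' c : L} (hγ : Valued.v γ ≤ Valued.v t)
    (hγ' : Valued.v γ' ≤ Valued.v t) (h : HasCarlitzExp (Fintype.card k) t γ c)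
    (h' : HasCarlitzExp (Fintype.card k) t γ' c) : γ = γ' := by
  have h1 := valuation_eq Fintype.one_lt_card ht (Valuation.map_sub_le _ hγ hγ') (sub h h')
  rw [sub_self, map_zero, eq_comm, Valuation.zero_iff] at h1
  exact sub_eq_zero.mp h1

theorem sum {ι : Type*} (s : Finset ι) {γ c : ι → L}
    (h : ∀ i, HasCarlitzExp (Fintype.card k) t (γ i) (c i)) :
    HasCarlitzExp (Fintype.card k) t (∑ i ∈ s, γ i) (∑ i ∈ s, c i) := by
  classical
  induction s using Finset.induction_on with
  | empty =>
    refine HasSum.congr_fun hasSum_zero fun i => ?_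
    rw [Finset.sum_empty, zero_pow (pow_ne_zero _ Fintype.card_ne_zero), mul_zero]
  | insert i s hi ih =>
    rw [Finset.sum_insert hi, Finset.sum_insert hi]
    exact (h i).add (k := k) ih

variable [MulArchimedean Γ₀] [CompleteSpace L]

theorem exists_hasCarlitzExp (q : ℕ) (hq : 2 ≤ q) (ht : 1 < Valued.v t) {γ : L}
    (hγ : Valued.v γ ≤ Valued.v t) : ∃ c, HasCarlitzExp q t γ c :=
  Valued.summable_of_le_geometric (valuation_inv_lt_one ht) (valuation_term_le q hq ht hγ)

variable (k) in
/-- The Carlitz exponential maps the disc `|γ| ≤ |t|` onto itself. -/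
theorem exists_log (ht : 1 < Valued.v t) {c : L} (hc : Valued.v c ≤ Valued.v t) :
    ∃ γ, Valued.v γ ≤ Valued.v t ∧ HasCarlitzExp (Fintype.card k) t γ c := by
  have hq : 2 ≤ Fintype.card k := Fintype.one_lt_card
  choose! e he using fun γ (hγ : Valued.v γ ≤ Valued.v t) =>
    exists_hasCarlitzExp (Fintype.card k) hq ht hγ
  -- The inverse of `exp` is the Neumann series `∑ (1 - exp)ⁿ`. Thus `δ n = (1 - exp)ⁿ c`, which
  -- shrinks by a factor `|t|⁻¹` at each step, and the logarithm is `∑ δ n`.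
  let δ : ℕ → L := fun n => (fun x => x - e x)^[n] c
  have hδs : ∀ n, δ (n + 1) = δ n - e (δ n) := fun n => Function.iterate_succ_apply' _ _ _
  have hδ : ∀ n, Valued.v (δ n) ≤ Valued.v (t⁻¹ ^ n * c) ∧ Valued.v (δ n) ≤ Valued.v t := by
    intro n
    induction n with
    | zero => exact ⟨by simp [δ], hc⟩
    | succ n ih =>
      have h1 := valuation_sub_le hq ht ih.2 (he _ ih.2)
      rw [Valuation.map_sub_swap, ← hδs] at h1
      refine ⟨h1.trans ?_, h1.trans ((valuation_inv_mul_le ht _).trans ih.2)⟩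
      rw [pow_succ', mul_assoc, map_mul, map_mul Valued.v t⁻¹]
      gcongr
      exact ih.1
  obtain ⟨γ, hγ⟩ := Valued.summable_of_le_geometric (valuation_inv_lt_one ht) fun n => (hδ n).1
  have hγt : Valued.v γ ≤ Valued.v t := Valued.map_hasSum_le hγ fun n => (hδ n).2
  refine ⟨γ, hγt, ?_⟩
  -- Since `exp (δ i) = δ i - δ (i + 1)`, the exponential of a partial sum telescopes to `c - δ n`.
  -- The tail of the series and `δ n` are both at most `|t⁻ⁿ c|`, so by the isometry `c - exp γ` is
  -- too, for every `n`.
  have key : c - e γ = 0 := by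
    refine Valuation.eq_zero_of_forall_le_pow (v := Valued.v) (valuation_inv_lt_one ht)
      (c := c) fun n => ?_
    have h1 := sum (k := k) (Finset.range n) fun i => he _ (hδ i).2
    have h2 : ∑ i ∈ Finset.range n, e (δ i) = c - δ n := by
      have := Finset.sum_range_sub' δ n
      simp only [hδs, sub_sub_cancel] at this
      exact this
    rw [h2] at h1
    have htail := (hasSum_nat_add_iff' n).mpr hγ
    have hle : Valued.v (γ - ∑ i ∈ Finset.range n, δ i) ≤ Valued.v (t⁻¹ ^ n * c) := by
      refine Valued.map_hasSum_le htail fun i => (hδ _).1.trans ?_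
      rw [pow_add, mul_assoc, map_mul]
      refine mul_le_of_le_one_left' ?_
      rw [map_pow]
      exact pow_le_one₀ zero_le (valuation_inv_lt_one ht).le
    have hle' : Valued.v (γ - ∑ i ∈ Finset.range n, δ i) ≤ Valued.v t :=
      Valuation.map_sub_le _ hγt (Valuation.map_sum_le _ fun i _ => (hδ i).2)
    have h3 := valuation_eq hq ht hle' (sub (he _ hγt) h1)
    have h4 : c - e γ = δ n - (e γ - (c - δ n)) := by ring
    rw [h4]
    exact Valuation.map_sub_le _ (hδ n).1 (h3.trans_le hle)
  rw [sub_eq_zero.mp key]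
  exact he _ hγt

end CarlitzExp

/-! ### From exact sequences of presheaves to exact sequences of sheaves. -/

theorem CategoryTheory.ShortComplex.exact_of_evaluation {J : Type*} [Category J]
    {C : Type*} [Category C] [Abelian C] (S : ShortComplex (J ⥤ C))
    (h : ∀ j, (S.map ((evaluation J C).obj j)).Exact) : S.Exact := by
  rw [ShortComplex.exact_iff_isZero_homology]
  rw [Functor.isZero_iff]
  intro j
  exact ((ShortComplex.exact_iff_isZero_homology _).mp (h j)).of_iso
    (S.mapHomologyIso ((evaluation J C).obj j)).symm

/-- Sheafification preserves exactness and monomorphisms, and makes a locally surjective map an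
epimorphism. As `F` is already a sheaf, the counit identifies it with its own sheafification. Hence
exactness may be checked on each open set, while surjectivity is needed only locally. -/
theorem CategoryTheory.Presheaf.exists_shortExact_presheafToSheaf {C : Type u} [SmallCategory C]
    (J : GrothendieckTopology C) {R : Type u} [CommRing R] {P Q : Cᵒᵖ ⥤ ModuleCat.{u} R}
    (F : Sheaf J (ModuleCat.{u} R)) (f : P ⟶ Q) (g : Q ⟶ F.obj)
    (hinj : ∀ U, Function.Injective (f.app U).hom)
    (hex : ∀ U, Function.Exact (f.app U).hom (g.app U).hom)
    (hsurj : Presheaf.IsLocallySurjective J g) :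
    ∃ (π : (presheafToSheaf J _).obj Q ⟶ F)
      (w : (presheafToSheaf J _).map f ≫ π = 0),
      (ShortComplex.mk ((presheafToSheaf J _).map f) π w).ShortExact := by
  let adj := sheafificationAdjunction J (ModuleCat.{u} R)
  let a := presheafToSheaf J (ModuleCat.{u} R)
  have hw : f ≫ g = 0 := by
    refine NatTrans.ext (funext fun U => ModuleCat.hom_ext (LinearMap.ext fun x => ?_))
    exact (hex U).apply_apply_eq_zero x
  let S : ShortComplex (Cᵒᵖ ⥤ ModuleCat.{u} R) := ShortComplex.mk f g hw
  have hS : S.Exact := ShortComplex.exact_of_evaluation _ fun U => by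
    rw [ShortComplex.moduleCat_exact_iff]
    intro x hx
    exact (hex U x).mp hx
  have hSa : (S.map a).Exact := hS.map a
  have : Mono f := by
    have hm : ∀ U, Mono (f.app U) := fun U => (ModuleCat.mono_iff_injective _).mpr (hinj U)
    exact NatTrans.mono_of_mono_app f
  let π : a.obj Q ⟶ F := a.map g ≫ adj.counit.app F
  have w : a.map f ≫ π = 0 := by
    rw [← Category.assoc, ← a.map_comp, hw, Functor.map_zero, Limits.zero_comp]
  have hepi : Epi (a.map g) := by
    have : Sheaf.IsLocallySurjective (a.map g) :=
      (Presheaf.isLocallySurjective_presheafToSheaf_map_iff _ g).mpr hsurj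
    infer_instance
  have : IsIso (adj.counit.app F) := isIso_sheafificationAdjunction_counit F
  let e : S.map a ≅ ShortComplex.mk (a.map f) π w :=
    ShortComplex.isoMk (Iso.refl _) (Iso.refl _) (@asIso _ _ _ _ (adj.counit.app F) this)
      ((Category.id_comp _).trans (Category.comp_id _).symm) (Category.id_comp _)
  refine ⟨π, w, { exact := (ShortComplex.exact_iff_of_iso e).mp hSa, mono_f := ?_, epi_g := ?_ }⟩
  · exact (inferInstance : Mono (a.map f))
  · exact (inferInstance : Epi (a.map g ≫ adj.counit.app F))

/-! ### Leading coefficients in `k[X] ⊗ M`. -/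

namespace PolynomialTensor

variable {k M N P : Type*} [Field k] [AddCommGroup M] [Module k M] [AddCommGroup N] [Module k N]
  [AddCommGroup P] [Module k[X] P]

/-- The coefficient of `X ^ n` of an element of `k[X] ⊗ M`. -/
def coeff (M : Type*) [AddCommGroup M] [Module k M] (n : ℕ) : k[X] ⊗[k] M →ₗ[k] M :=
  TensorProduct.lid k M ∘ₗ (Polynomial.lcoeff k n).rTensor M

theorem coeff_tmul (n : ℕ) (p : k[X]) (m : M) : coeff M n (p ⊗ₜ m) = p.coeff n • m := rfl

/-- Elements of `k[X] ⊗ M` are polynomials with coefficients in `M`; this form permits induction on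
the number of coefficients. -/
theorem exists_eq_sum (x : k[X] ⊗[k] M) :
    ∃ (n : ℕ) (f : ℕ → M), x = ∑ i ∈ Finset.range n, ((Polynomial.X : k[X]) ^ i) ⊗ₜ f i := by
  suffices h : ∃ f : ℕ →₀ M, x = f.sum fun i m => ((Polynomial.X : k[X]) ^ i) ⊗ₜ m by
    obtain ⟨f, rfl⟩ := h
    exact ⟨f.support.sup id + 1, f, Finsupp.sum_of_support_subset _ (fun i hi =>
      Finset.mem_range_succ_iff.mpr (Finset.le_sup (f := id) hi)) _
      fun i _ => TensorProduct.tmul_zero _ _⟩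
  induction x with
  | zero => exact ⟨0, by simp⟩
  | tmul p m =>
    induction p using Polynomial.induction_on' with
    | add p q hp hq =>
      obtain ⟨f, hf⟩ := hp
      obtain ⟨g, hg⟩ := hq
      exact ⟨f + g, by rw [TensorProduct.add_tmul, hf, hg, Finsupp.sum_add_index'
        (fun _ => TensorProduct.tmul_zero _ _) fun _ _ _ => TensorProduct.tmul_add _ _ _]⟩
    | monomial n a =>
      refine ⟨Finsupp.single n (a • m), ?_⟩
      rw [Finsupp.sum_single_index (by simp), ← TensorProduct.smul_tmul,
        Polynomial.smul_X_eq_monomial]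
  | add x y hx hy =>
    obtain ⟨f, rfl⟩ := hx
    obtain ⟨g, rfl⟩ := hy
    exact ⟨f + g, (Finsupp.sum_add_index' (fun _ => TensorProduct.tmul_zero _ _)
      fun _ _ _ => TensorProduct.tmul_add _ _ _).symm⟩

/-- The map `a ⊗ m ↦ Xa ⊗ ι m - a ⊗ φ m`. -/
def boundary (ι φ : M →ₗ[k] N) : k[X] ⊗[k] M →ₗ[k[X]] k[X] ⊗[k] N :=
  (Polynomial.X : k[X]) • ι.baseChange k[X] - φ.baseChange k[X]

theorem boundary_tmul (ι φ : M →ₗ[k] N) (a : k[X]) (m : M) :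
    boundary ι φ (a ⊗ₜ m) = (Polynomial.X * a) ⊗ₜ ι m - a ⊗ₜ φ m := by
  simp [boundary, TensorProduct.smul_tmul']

/-- `X ι - φ` raises the degree by one and acts on the leading coefficient through `ι`, so the
leading coefficient of an element of the kernel vanishes. -/
theorem boundary_injective {ι : M →ₗ[k] N} (hι : Function.Injective ι) (φ : M →ₗ[k] N) :
    Function.Injective (boundary ι φ) := by
  rw [injective_iff_map_eq_zero]
  intro x hx
  obtain ⟨n, f, rfl⟩ := exists_eq_sum x
  induction n with
  | zero => simp
  | succ n ih =>
    have h := congrArg (coeff N (n + 1)) hx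
    simp only [map_sum, boundary_tmul, map_sub, coeff_tmul, map_zero, ← pow_succ',
      Polynomial.coeff_X_pow] at h
    rw [Finset.sum_eq_single_of_mem n (Finset.self_mem_range_succ n)] at h
    · have h0 : f n = 0 := hι (by simpa using h)
      rw [Finset.sum_range_succ, h0, TensorProduct.tmul_zero, add_zero] at hx ⊢
      exact ih hx
    · intro i hi hin
      have := Finset.mem_range_succ_iff.mp hi
      rw [if_neg (by omega), if_neg (by omega)]
      simp

/-- The `k[X]`-linear map `a ⊗ n ↦ a • π n`. -/
def lift (π : N →+ P) (hπ : ∀ (a : k) (n : N), π (a • n) = Polynomial.C a • π n) :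
    k[X] ⊗[k] N →ₗ[k[X]] P :=
  -- `P` comes only with a `k[X]`-structure; its `k`-structure is obtained by restriction along `C`,
  -- which is why `π` enters as an additive map together with `hπ`.
  letI : Module k P := Module.compHom P (Polynomial.C : k →+* k[X])
  haveI : IsScalarTower k k[X] P :=
    ⟨fun a p x => by rw [Polynomial.smul_eq_C_mul, mul_smul]; rfl⟩
  LinearMap.liftBaseChange k[X] { π with map_smul' := hπ }

theorem lift_tmul (π : N →+ P) (hπ : ∀ (a : k) (n : N), π (a • n) = Polynomial.C a • π n)
    (a : k[X]) (n : N) : lift π hπ (a ⊗ₜ n) = a • π n :=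
  rfl

/-- Descent on the degree: `htop` writes the leading coefficient of an element of the kernel as `ι
m`, and subtracting `boundary (X ^ n ⊗ m)` removes it. The range `n + 2` in `htop` restricts it to
positive degree; degree zero is covered by `hinj`. -/
theorem exact_boundary (ι φ : M →ₗ[k] N) (π : N →+ P)
    (hlin : ∀ (a : k) (n : N), π (a • n) = Polynomial.C a • π n)
    (hπ : ∀ m, (Polynomial.X : k[X]) • π (ι m) = π (φ m)) (hinj : Function.Injective π)
    (htop : ∀ (n : ℕ) (f : ℕ → N),
      ∑ i ∈ Finset.range (n + 2), (Polynomial.X : k[X]) ^ i • π (f i) = 0 →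
        f (n + 1) ∈ LinearMap.range ι) :
    Function.Exact (boundary ι φ) (lift π hlin) := by
  have hcomp : ∀ x, lift π hlin (boundary ι φ x) = 0 := by
    intro x
    induction x with
    | zero => simp
    | tmul a m =>
      rw [boundary_tmul, map_sub, lift_tmul, lift_tmul,
        mul_comm, mul_smul, hπ, sub_self]
    | add x y hx hy => rw [map_add, map_add, hx, hy, add_zero]
  intro x
  refine ⟨fun hx => ?_, ?_⟩
  · obtain ⟨n, f, rfl⟩ := exists_eq_sum x
    induction n generalizing f with
    | zero => exact ⟨0, by simp⟩
    | succ n ih =>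
      rcases n with _ | n
      · have h0 : f 0 = 0 := hinj (by simpa [lift_tmul] using hx)
        exact ⟨0, by simp [h0]⟩
      · obtain ⟨m, hm⟩ := htop n f (by simpa [map_sum, lift_tmul] using hx)
        let y : k[X] ⊗[k] M := ((Polynomial.X : k[X]) ^ n) ⊗ₜ m
        -- Replacing `X ^ (n + 1) ⊗ ι m` by `X ^ n ⊗ φ m` changes only the coefficient of `X ^ n`.
        let g : ℕ → N := fun i => if i = n then f i + φ m else f i
        have key : ∑ i ∈ Finset.range (n + 2), ((Polynomial.X : k[X]) ^ i) ⊗ₜ f i -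
            boundary ι φ y = ∑ i ∈ Finset.range (n + 1), ((Polynomial.X : k[X]) ^ i) ⊗ₜ[k] g i := by
          rw [boundary_tmul, hm, ← pow_succ', Finset.sum_range_succ, Finset.sum_range_succ,
            Finset.sum_range_succ]
          have : ∀ i ∈ Finset.range n, ((Polynomial.X : k[X]) ^ i) ⊗ₜ[k] g i =
              ((Polynomial.X : k[X]) ^ i) ⊗ₜ[k] f i := fun i hi => by
            simp [g, (Finset.mem_range.mp hi).ne]
          rw [Finset.sum_congr rfl this]
          simp only [g, if_true, TensorProduct.tmul_add]
          abel
        obtain ⟨w, hw⟩ := ih g (by rw [← key, map_sub, hx, hcomp, sub_zero])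
        exact ⟨w + y, by rw [map_add, hw, ← key, sub_add_cancel]⟩
  · rintro ⟨y, rfl⟩
    exact hcomp y

end PolynomialTensor

/-! ### Points above infinity and local sections of `O_X(∞)`. -/

namespace CurveOverP1

variable {k : Type u} [Field k] (D : CurveOverP1 k)

theorem toK_injective (U : D.X.Opens) (hU : genericPoint D.X ∈ U) :
    Function.Injective (D.toK U hU) := by
  have : Nonempty U := ⟨⟨_, hU⟩⟩
  exact Scheme.germToFunctionField_injective D.X U

/-- Generizations of `z` are primes of its local ring, a local Dedekind domain, so they come from
the zero or the maximal ideal. The generic point must come from the zero ideal, since it lies in `Y`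
and `z` does not. -/
theorem eq_generic_or_eq_of_specializes {z : D.Infty} {w : D.X} (h : w ⤳ z.1) :
    w = genericPoint D.X ∨ w = z.1 := by
  have hmem : ∀ {w : D.X}, w ⤳ z.1 → ∃ p, D.X.fromSpecStalk z.1 p = w := fun {w} h => by
    have : w ∈ Set.range (D.X.fromSpecStalk z.1) := by
      rw [Scheme.range_fromSpecStalk]
      exact h
    exact this
  have hmax : ∀ p : Spec (D.X.presheaf.stalk z.1), p.asIdeal ≠ ⊥ →
      D.X.fromSpecStalk z.1 p = z.1 := by
    intro p hp
    have h1 : p = IsLocalRing.closedPoint (D.X.presheaf.stalk z.1) :=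
      PrimeSpectrum.ext (IsLocalRing.eq_maximalIdeal (p.isPrime.isMaximal hp))
    rw [h1]
    exact Scheme.fromSpecStalk_closedPoint
  obtain ⟨p, hp⟩ := hmem h
  obtain ⟨p₀, hp₀⟩ := hmem ((genericPoint_spec D.X).specializes (Set.mem_univ z.1))
  have hp₀' : p₀.asIdeal = ⊥ := by
    by_contra h0
    exact z.2 (hmax p₀ h0 ▸ hp₀ ▸ D.generic_mem_Y)
  by_cases h0 : p.asIdeal = ⊥
  · left
    rw [← hp, ← hp₀]
    congr 1
    exact PrimeSpectrum.ext (h0.trans hp₀'.symm)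
  · right
    rw [← hp]
    exact hmax p h0

theorem eq_of_specializes {z w : D.Infty} (h : w.1 ⤳ z.1) : w = z :=
  Subtype.ext ((D.eq_generic_or_eq_of_specializes h).resolve_left
    fun h' => w.2 (h' ▸ D.generic_mem_Y))

instance : NoetherianSpace D.X := by
  have := D.smooth
  have := D.proper
  have : IsLocallyNoetherian D.X := LocallyOfFiniteType.isLocallyNoetherian D.str
  have : CompactSpace D.X := QuasiCompact.compactSpace_of_compactSpace D.str
  have : IsNoetherian D.X := {}
  infer_instance

instance : Finite D.Infty := by
  -- The complement of `Y` is a finite union of irreducible closed sets. The generic point of each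
  -- also lies above `∞`, so there are no proper specializations and each set is a single point.
  obtain ⟨S, hS, hcl, hirr, hsup⟩ := NoetherianSpace.exists_finite_set_isClosed_irreducible
    D.Y.isOpen.isClosed_compl
  have hsub : ∀ T ∈ S, ∀ x ∈ T, x ∉ D.Y := fun T hT x hx =>
    show x ∈ (D.Y : Set D.X)ᶜ from hsup ▸ Set.mem_sUnion_of_mem hx hT
  have hfin : ((D.Y : Set D.X)ᶜ).Finite := by
    rw [hsup]
    refine hS.sUnion fun T hT => ?_
    obtain ⟨η, hη⟩ := QuasiSober.sober (hirr T hT) (hcl T hT)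
    have hηY := hsub T hT η (hη.mem)
    have h : ∀ x ∈ T, η = x := fun x hx => congrArg Subtype.val
      (D.eq_of_specializes (w := ⟨η, hηY⟩) (z := ⟨x, hsub T hT x hx⟩) (hη.specializes hx))
    exact Set.Subsingleton.finite fun x hx y hy => (h x hx).symm.trans (h y hy)
  exact hfin.to_subtype

/-- A point above `∞` has a neighbourhood that contains no other point above `∞`. -/
theorem exists_nhd_infty (z : D.Infty) : ∃ U : D.X.Opens, z.1 ∈ U ∧
    ∀ w : D.Infty, w.1 ∈ U → w = z := by
  have hcl : ∀ w : D.Infty, IsClosed {w.1} := by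
    intro w
    refine isClosed_of_closure_subset fun x hx => ?_
    have hx' : x ∉ D.Y := closure_minimal (Set.singleton_subset_iff.mpr w.2)
      D.Y.isOpen.isClosed_compl hx
    exact congrArg Subtype.val
      (D.eq_of_specializes (z := ⟨x, hx'⟩) (specializes_iff_mem_closure.mpr hx)).symm
  let T : Set D.X := ⋃ w : {w : D.Infty // w ≠ z}, {w.1.1}
  have hT : IsClosed T := isClosed_iUnion_of_finite fun w => hcl w.1
  refine ⟨⟨Tᶜ, hT.isOpen_compl⟩, ?_, ?_⟩
  · intro h
    obtain ⟨w, hw⟩ := Set.mem_iUnion.mp h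
    exact w.2 (Subtype.ext hw.symm)
  · intro w hw
    by_contra hne
    exact hw (Set.mem_iUnion.mpr ⟨⟨w, hne⟩, rfl⟩)

theorem eq_place (z : D.Infty)
    (v : IsDedekindDomain.HeightOneSpectrum (D.X.presheaf.stalk z.1)) : v = D.place z :=
  IsDedekindDomain.HeightOneSpectrum.ext (IsLocalRing.eq_maximalIdeal v.isMaximal)

theorem valued_algebraMap (z : D.Infty) (x : D.K) :
    Valued.v (algebraMap D.K (D.Kz z) x) = (D.place z).valuation D.K x := by
  rw [← IsDedekindDomain.HeightOneSpectrum.adicCompletion.valued_coe]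
  rfl

/-- A Dedekind domain is the intersection of its valuation rings, and the local ring at `z` has only
one. -/
theorem valued_le_one_iff (z : D.Infty) (x : D.K) :
    Valued.v (algebraMap D.K (D.Kz z) x) ≤ 1 ↔
      ∃ g : D.X.presheaf.stalk z.1, algebraMap _ D.K g = x := by
  rw [valued_algebraMap]
  constructor
  · intro h
    exact IsDedekindDomain.HeightOneSpectrum.mem_integers_of_valuation_le_one D.K x
      fun v => (D.eq_place z v) ▸ h
  · rintro ⟨g, rfl⟩
    exact IsDedekindDomain.HeightOneSpectrum.valuation_le_one _ _

theorem one_lt_valued_tz (z : D.Infty) : 1 < Valued.v (D.tz z) := by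
  obtain ⟨s, hs, h⟩ := D.exists_inv_t z
  have h1 : (D.place z).valuation D.K (algebraMap _ D.K s) < 1 :=
    (IsDedekindDomain.HeightOneSpectrum.valuation_lt_one_iff_mem _ _).mpr hs
  have h2 : (D.place z).valuation D.K (algebraMap _ D.K s) * (D.place z).valuation D.K D.t = 1 := by
    rw [← map_mul, h, map_one]
  rw [tz, valued_algebraMap]
  by_contra! h3
  exact absurd h2 (mul_lt_one_of_lt_of_le h1 h3).ne

theorem t_ne_zero (z : D.Infty) : D.t ≠ 0 := by
  obtain ⟨s, -, h⟩ := D.exists_inv_t z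
  rintro h0
  simp [h0] at h

/-- After division by `t`, the pole condition becomes integrality at `z`. Thus `O_X(∞)` matches the
disc on which the Carlitz logarithm exists. -/
theorem mem_OInftySections_iff {U : D.X.Opens} (f : Γ(D.X, U ⊓ D.Y)) :
    f ∈ D.OInftySections 1 U ↔
      ∀ z : D.InftyIn U, Valued.v (D.expand U z.1 z.2 f) ≤ Valued.v (D.tz z.1) := by
  refine forall_congr' fun z => ?_
  have ht0 : 0 < Valued.v (D.tz z.1) := zero_lt_one.trans (D.one_lt_valued_tz z.1)
  have hx : Valued.v (D.expand U z.1 z.2 f) ≤ Valued.v (D.tz z.1) ↔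
      Valued.v (algebraMap D.K (D.Kz z.1) (D.toK _ (D.generic_mem_inf z.2) f / D.t)) ≤ 1 := by
    rw [map_div₀, map_div₀]
    exact (div_le_one₀ ht0).symm
  rw [hx, valued_le_one_iff]
  refine exists_congr fun g => ?_
  rw [zpow_one, eq_div_iff (D.t_ne_zero z.1), mul_comm, eq_comm]

/-- A function on `U ∩ Y` that is regular at the points of `U` above `∞` extends to `U`. -/
theorem exists_res_eq {U : D.X.Opens} (f : Γ(D.X, U ⊓ D.Y))
    (hf : ∀ z : D.InftyIn U, ∃ g : D.X.presheaf.stalk z.1.1,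
      algebraMap _ D.K g = D.toK (U ⊓ D.Y) (D.generic_mem_inf z.2) f) :
    ∃ F : Γ(D.X, U), D.res inf_le_left F = f := by
  have hloc : ∀ z : D.InftyIn U, ∃ (V : D.X.Opens) (_ : V ≤ U) (hz : z.1.1 ∈ V) (g : Γ(D.X, V)),
      D.toK V (D.generic_mem hz) g = D.toK (U ⊓ D.Y) (D.generic_mem_inf z.2) f := by
    intro z
    obtain ⟨g, hg⟩ := hf z
    obtain ⟨V, hz, G, rfl⟩ := D.X.presheaf.exists_germ_eq g
    refine ⟨V ⊓ U, inf_le_right, ⟨hz, z.2⟩, D.res inf_le_left G, ?_⟩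
    rw [toK_res, ← hg, algebraMap_germ]
  choose V hVU hV g hg using hloc
  -- The cover consists of `U ∩ Y` (index `none`) and a neighbourhood of each point above `∞`.
  -- Sections agree on nonempty overlaps because they have the same germ in `K`; empty overlaps need
  -- a separate argument, as they miss the generic point.
  let W : Option (D.InftyIn U) → D.X.Opens := fun o => o.elim (U ⊓ D.Y) V
  let s : ∀ o, Γ(D.X, W o) := fun o => match o with
    | none => f
    | some z => g z
  have hWU : ∀ o, W o ≤ U := fun o => match o with
    | none => inf_le_left
    | some z => hVU z
  have hs : ∀ (o) (hη : genericPoint D.X ∈ W o) (hη' : genericPoint D.X ∈ U ⊓ D.Y),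
      D.toK (W o) hη (s o) = D.toK (U ⊓ D.Y) hη' f := fun o hη hη' => match o with
    | none => rfl
    | some z => hg z
  obtain ⟨F, hF, -⟩ := TopCat.Sheaf.existsUnique_gluing' D.X.sheaf W U (fun o => homOfLE (hWU o))
    (fun x hx => by
      by_cases hxY : x ∈ D.Y
      · exact Opens.mem_iSup.mpr ⟨none, hx, hxY⟩
      · exact Opens.mem_iSup.mpr ⟨some ⟨⟨x, hxY⟩, hx⟩, hV _⟩) s (by
      intro i j
      by_cases hne : ∃ x, x ∈ W i ⊓ W j
      · obtain ⟨x, hx⟩ := hne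
        have hη := D.generic_mem hx
        have hηU : genericPoint D.X ∈ U ⊓ D.Y := ⟨hWU i hη.1, D.generic_mem_Y⟩
        refine D.toK_injective _ hη ?_
        change D.toK _ hη (D.res inf_le_left (s i)) = D.toK _ hη (D.res inf_le_right (s j))
        rw [toK_res, toK_res, hs i hη.1 hηU, hs j hη.2 hηU]
      · have hbot : W i ⊓ W j = ⊥ := by
          rw [eq_bot_iff]
          exact fun x hx => (hne ⟨x, hx⟩).elim
        have : Subsingleton Γ(D.X, W i ⊓ W j) := by
          rw [hbot]
          infer_instance
        exact Subsingleton.elim (α := Γ(D.X, W i ⊓ W j)) _ _)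
  exact ⟨F, hF none⟩

theorem valued_algebraMap_le_one (z : D.Infty) (a : k) :
    Valued.v (algebraMap k (D.Kz z) a) ≤ 1 := by
  rw [IsScalarTower.algebraMap_apply k D.K (D.Kz z), valued_le_one_iff]
  refine ⟨D.X.presheaf.germ ⊤ z.1 (Opens.mem_top z.1) (algebraMap k Γ(D.X, ⊤) a), ?_⟩
  exact (D.algebraMap_germ _ _).trans (D.toK_algebraMap _ _ a)

theorem valued_expand_incl_le_one (U : D.X.Opens) (f : Γ(D.X, U)) (z : D.InftyIn U) :
    Valued.v (D.expand U z.1 z.2 (D.incl U f).1) ≤ 1 := by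
  refine (D.valued_le_one_iff z.1 _).mpr ⟨D.X.presheaf.germ U z.1.1 z.2 f, ?_⟩
  rw [algebraMap_germ]
  exact (D.toK_res inf_le_left (D.generic_mem_inf z.2) f).symm

/-- Every element of the completion with a pole of order at most that of `t` agrees up to an
integral element with a section of `O_X(∞)` near the given point. -/
theorem exists_approx {U : D.X.Opens} (z : D.InftyIn U) (y : D.Kz z.1)
    (hy : Valued.v y ≤ Valued.v (D.tz z.1)) :
    ∃ (V : D.X.Opens) (_ : V ≤ U) (hz : z.1.1 ∈ V) (f : Γ(D.X, V ⊓ D.Y)),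
      Valued.v (D.expand V z.1 hz f) ≤ Valued.v (D.tz z.1) ∧
      Valued.v (y - D.expand V z.1 hz f) ≤ 1 := by
  have hopen : IsOpen {x : D.Kz z.1 | Valued.v (y - x) ≤ 1} := by
    have : IsOpen ((Valued.v : Valuation (D.Kz z.1) _).integer : Set (D.Kz z.1)) :=
      Valued.isOpen_integer _
    exact this.preimage (continuous_const.sub continuous_id)
  obtain ⟨a, ha⟩ := (IsDedekindDomain.HeightOneSpectrum.denseRange_algebraMap D.K
    (D.place z.1)).exists_mem_open hopen ⟨y, by simp⟩
  have ha1 : Valued.v (y - algebraMap D.K (D.Kz z.1) a) ≤ 1 := ha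
  have ht := D.one_lt_valued_tz z.1
  have ha2 : Valued.v (algebraMap D.K (D.Kz z.1) a) ≤ Valued.v (D.tz z.1) := by
    have := Valuation.map_sub_le Valued.v hy (ha1.trans ht.le)
    rwa [sub_sub_cancel] at this
  -- Dividing by `t` makes `a` integral at `z`, so `a / t` is the germ of a function `G` near `z`,
  -- and `f = G t` is regular on the part of that neighbourhood in `Y`.
  have ha3 : Valued.v (algebraMap D.K (D.Kz z.1) (a / D.t)) ≤ 1 := by
    rw [map_div₀, map_div₀]
    exact (div_le_one₀ (zero_lt_one.trans ht)).mpr ha2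
  obtain ⟨g, hg⟩ := (D.valued_le_one_iff z.1 _).mp ha3
  obtain ⟨V, hz, G, rfl⟩ := D.X.presheaf.exists_germ_eq g
  rw [algebraMap_germ, eq_div_iff (D.t_ne_zero z.1)] at hg
  have hW : V ⊓ U ≤ U := inf_le_right
  have hzW : z.1.1 ∈ V ⊓ U := ⟨hz, z.2⟩
  obtain ⟨f, hfa⟩ : ∃ f, D.expand (V ⊓ U) z.1 hzW f = algebraMap D.K (D.Kz z.1) a := by
    refine ⟨D.res (inf_le_left.trans inf_le_left) G * D.tOn (V ⊓ U), ?_⟩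
    refine congrArg (algebraMap D.K (D.Kz z.1)) ?_
    rw [map_mul, toK_res, toK_tOn]
    exact hg
  refine ⟨V ⊓ U, hW, hzW, f, ?_, ?_⟩
  · rw [hfa]
    exact ha2
  · rw [hfa]
    exact ha1

theorem incl_injective (U : D.X.Opens) : Function.Injective (D.incl U) := by
  by_cases hne : ∃ x, x ∈ U
  · obtain ⟨x, hx⟩ := hne
    intro f g h
    refine D.toK_injective U (D.generic_mem hx) ?_
    have h1 := congrArg (fun a => D.toK _ (D.generic_mem_inf hx) a.1) h
    exact (D.toK_res _ _ f).symm.trans (h1.trans (D.toK_res _ _ g))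
  · have hbot : U = ⊥ := by
      rw [eq_bot_iff]
      exact fun x hx => (hne ⟨x, hx⟩).elim
    have : Subsingleton Γ(D.X, U) := by
      rw [hbot]
      infer_instance
    exact Function.injective_of_subsingleton _

/-! ### The logarithm of a section of `O_X(∞)`. -/

variable [Fintype k]

theorem exists_logz (U : D.X.Opens) (f : D.OInftySections 1 U) (z : D.InftyIn U) :
    ∃ γ, Valued.v γ ≤ Valued.v (D.tz z.1) ∧
      HasCarlitzExp (Fintype.card k) (D.tz z.1) γ (D.expand U z.1 z.2 f.1) :=
  CarlitzExp.exists_log k (D.one_lt_valued_tz z.1) ((D.mem_OInftySections_iff f.1).mp f.2 z)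

/-- The Carlitz logarithm of a section of `O_X(∞)` at a point above `∞`. -/
def logz (U : D.X.Opens) (f : D.OInftySections 1 U) (z : D.InftyIn U) : D.Kz z.1 :=
  (D.exists_logz U f z).choose

theorem logz_le (U : D.X.Opens) (f : D.OInftySections 1 U) (z : D.InftyIn U) :
    Valued.v (D.logz U f z) ≤ Valued.v (D.tz z.1) :=
  (D.exists_logz U f z).choose_spec.1

theorem hasCarlitzExp_logz (U : D.X.Opens) (f : D.OInftySections 1 U) (z : D.InftyIn U) :
    HasCarlitzExp (Fintype.card k) (D.tz z.1) (D.logz U f z) (D.expand U z.1 z.2 f.1) :=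
  (D.exists_logz U f z).choose_spec.2

/-- Uniqueness of the logarithm in the disc; linearity and compatibility with restriction and with
`t` all follow by exhibiting a candidate in the disc. -/
theorem eq_logz {U : D.X.Opens} {f : D.OInftySections 1 U} {z : D.InftyIn U} {γ : D.Kz z.1}
    (h : Valued.v γ ≤ Valued.v (D.tz z.1))
    (h' : HasCarlitzExp (Fintype.card k) (D.tz z.1) γ (D.expand U z.1 z.2 f.1)) :
    γ = D.logz U f z :=
  CarlitzExp.eq_of_hasCarlitzExp k (D.one_lt_valued_tz z.1) h (D.logz_le U f z) h'
    (D.hasCarlitzExp_logz U f z)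

theorem valued_logz (U : D.X.Opens) (f : D.OInftySections 1 U) (z : D.InftyIn U) :
    Valued.v (D.logz U f z) = Valued.v (D.expand U z.1 z.2 f.1) :=
  (CarlitzExp.valuation_eq Fintype.one_lt_card (D.one_lt_valued_tz z.1) (D.logz_le U f z)
    (D.hasCarlitzExp_logz U f z)).symm

theorem logz_add (U : D.X.Opens) (f g : D.OInftySections 1 U) (z : D.InftyIn U) :
    D.logz U (f + g) z = D.logz U f z + D.logz U g z := by
  refine (D.eq_logz (Valuation.map_add_le _ (D.logz_le U f z) (D.logz_le U g z)) ?_).symm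
  have h := (D.hasCarlitzExp_logz U f z).add (k := k) (D.hasCarlitzExp_logz U g z)
  rwa [← map_add] at h

theorem logz_smul (U : D.X.Opens) (a : k) (f : D.OInftySections 1 U) (z : D.InftyIn U) :
    D.logz U (a • f) z = a • D.logz U f z := by
  refine (D.eq_logz ?_ ?_).symm
  · rw [Algebra.smul_def, map_mul]
    exact (mul_le_of_le_one_left' (D.valued_algebraMap_le_one z.1 a)).trans (D.logz_le U f z)
  · have h := (D.hasCarlitzExp_logz U f z).smul a
    rw [Algebra.smul_def a (D.expand U z.1 z.2 f.1), ← D.expand_algebraMap U z.1 z.2, ← map_mul,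
      ← Algebra.smul_def] at h
    exact h

theorem logz_res {U V : D.X.Opens} (h : V ≤ U) (f : D.OInftySections 1 U) (z : D.InftyIn V) :
    D.logz V (D.OInftyRes 1 h f) z = D.logz U f ⟨z.1, h z.2⟩ := by
  refine (D.eq_logz (f := D.OInftyRes 1 h f) (z := z) (γ := D.logz U f ⟨z.1, h z.2⟩)
    (D.logz_le U f ⟨z.1, h z.2⟩) ?_).symm
  have h1 : D.expand V z.1 z.2 (D.OInftyRes 1 h f).1 = D.expand U z.1 (h z.2) f.1 :=
    D.expand_res h z.1 z.2 f.1
  rw [h1]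
  exact D.hasCarlitzExp_logz U f ⟨z.1, h z.2⟩

/-- The functional equation gives `exp (t log f) = tf + f ^ q`. Regularity of `f` is what keeps `t
log f` in the disc: `|log f| = |f| ≤ 1`. -/
theorem logz_carlitzO (U : D.X.Opens) (f : Γ(D.X, U)) (z : D.InftyIn U) :
    D.logz U (D.carlitzO U f) z = D.tz z.1 * D.logz U (D.incl U f) z := by
  refine (D.eq_logz ?_ ?_).symm
  · rw [map_mul, valued_logz]
    exact mul_le_of_le_one_right' (D.valued_expand_incl_le_one U f z)
  · have h := (D.hasCarlitzExp_logz U (D.incl U f) z).mul (k := k) fun i =>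
      D.t_pow_ne z.1 _ ((Fintype.one_lt_card).trans_le (Nat.le_self_pow (Nat.succ_ne_zero i) _))
    rw [carlitzMap_apply, ← D.expand_tOn U z.1 z.2, ← map_pow, ← map_mul, ← map_add,
      D.expand_tOn U z.1 z.2] at h
    exact h

end CurveOverP1

/-! ### The map from `O_X(∞) ⊗ A` to `C` and exactness on sections. -/

theorem MulModule.of_symm_X_pow_smul {k R : Type u} [Field k] [CommRing R] [Algebra k R] {t : R}
    (n : ℕ) (m : MulModule k t) :
    (Module.AEval'.of _).symm ((Polynomial.X : k[X]) ^ n • m) =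
      t ^ n * (Module.AEval'.of _).symm m := by
  induction n with
  | zero => simp
  | succ n ih =>
    rw [pow_succ', mul_smul, pow_succ', mul_assoc, ← ih]
    exact Module.AEval.of_symm_X_smul _ _

namespace CurveOverP1

variable {k : Type u} [Field k] [Fintype k] (D : CurveOverP1 k)

instance (U : D.X.Opens) : AddCommGroup (D.CSections U) := (D.CSections U).addCommGroup

instance (U : D.X.Opens) : AddCommMonoid (D.CSections U) := (D.CSections U).addCommMonoid

instance (U : D.X.Opens) : Module k[X] (D.CSections U) := (D.CSections U).module

instance (U : D.X.Opens) : SMul k[X] (D.CSections U) := (D.CSections U).smul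

instance (U : D.X.Opens) : Add (D.CSections U) := (D.CSections U).add

/-- The pair `(f, log f)`, as a section of `C`. -/
def logSection (U : D.X.Opens) : D.OInftySections 1 U →+ D.CSections U where
  toFun f := ⟨(Module.AEval'.of _ f.1, fun z => Module.AEval'.of _ (D.logz U f z)),
    fun z => D.hasCarlitzExp_logz U f z⟩
  map_zero' := by
    refine Subtype.ext (Prod.ext rfl (funext fun z => ?_))
    have h := D.logz_smul U 0 0 z
    rw [zero_smul, zero_smul] at h
    exact congrArg (Module.AEval'.of _) h
  map_add' f g := Subtype.ext (Prod.ext rfl (funext fun z =>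
    congrArg (Module.AEval'.of _) (D.logz_add U f g z)))

theorem logSection_smul (U : D.X.Opens) (a : k) (f : D.OInftySections 1 U) :
    D.logSection U (a • f) = (Polynomial.C a : k[X]) • D.logSection U f := by
  refine Subtype.ext (Prod.ext ?_ (funext fun z => ?_))
  · exact (Module.AEval.C_smul _ a (Module.AEval'.of _ f.1)).symm
  · exact (congrArg (Module.AEval'.of _) (D.logz_smul U a f z)).trans
      (Module.AEval.C_smul _ a (Module.AEval'.of _ (D.logz U f z))).symm

theorem logSection_injective (U : D.X.Opens) : Function.Injective (D.logSection U) := fun _ _ h =>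
  Subtype.ext (congrArg (fun x : D.CSections U => (Module.AEval'.of _).symm x.1.1) h)

theorem logSection_fst (U : D.X.Opens) (f : D.OInftySections 1 U) :
    (D.logSection U f).1.1 = Module.AEval'.of _ f.1 := rfl

theorem logSection_snd (U : D.X.Opens) (f : D.OInftySections 1 U) (z : D.InftyIn U) :
    (D.logSection U f).1.2 z = Module.AEval'.of _ (D.logz U f z) := rfl

theorem logSection_res {U V : D.X.Opens} (h : V ≤ U) (f : D.OInftySections 1 U) :
    D.logSection V (D.OInftyRes 1 h f) = D.CRes h (D.logSection U f) := by
  refine Subtype.ext (Prod.ext ?_ (funext fun z => ?_))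
  · refine Eq.trans ?_ (D.CRes_fst h (D.logSection U f)).symm
    rw [logSection_fst, logSection_fst]
    rfl
  · refine Eq.trans ?_ (D.CRes_snd h (D.logSection U f) z).symm
    exact congrArg (Module.AEval'.of (LinearMap.mulLeft k (D.tz z.1))) (D.logz_res h f z)

theorem X_smul_logSection_incl (U : D.X.Opens) (f : Γ(D.X, U)) :
    (Polynomial.X : k[X]) • D.logSection U (D.incl U f) = D.logSection U (D.carlitzO U f) := by
  refine Subtype.ext (Prod.ext ?_ (funext fun z => ?_))
  · exact Module.AEval.X_smul_of _ _
  · refine (Module.AEval'.X_smul_of (LinearMap.mulLeft k (D.tz z.1)) _).trans ?_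
    exact congrArg (Module.AEval'.of _) (D.logz_carlitzO U f z).symm

/-- The component at a point above `∞` of a section of `C`. -/
def gammaz {U : D.X.Opens} (z : D.InftyIn U) : D.CSections U →+ D.Kz z.1 where
  toFun x := (Module.AEval'.of _).symm (x.1.2 z)
  map_zero' := map_zero _
  map_add' _ _ := map_add _ _ _

theorem gammaz_X_pow_smul {U : D.X.Opens} (z : D.InftyIn U) (n : ℕ) (x : D.CSections U) :
    D.gammaz z ((Polynomial.X : k[X]) ^ n • x) = D.tz z.1 ^ n * D.gammaz z x :=
  MulModule.of_symm_X_pow_smul n (x.1.2 z)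

theorem gammaz_logSection {U : D.X.Opens} (z : D.InftyIn U) (f : D.OInftySections 1 U) :
    D.gammaz z (D.logSection U f) = D.logz U f z := rfl

/-- Every lower term satisfies `|tⁱ log fᵢ| ≤ |t| ^ (i + 1) ≤ |t| ^ (n + 1)`, hence so does the top
one, and `|f_{n+1}| = |log f_{n+1}| ≤ 1`. A function regular at all points above `∞` extends to `U`.
-/
theorem top_coeff_mem_range_incl (U : D.X.Opens) (n : ℕ) (f : ℕ → D.OInftySections 1 U)
    (h : ∑ i ∈ Finset.range (n + 2), (Polynomial.X : k[X]) ^ i • D.logSection U (f i) = 0) :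
    f (n + 1) ∈ LinearMap.range (D.incl U) := by
  obtain ⟨F, hF⟩ := D.exists_res_eq (f (n + 1)).1 fun z => by
    rw [← valued_le_one_iff]
    change Valued.v (D.expand U z.1 z.2 (f (n + 1)).1) ≤ 1
    rw [← valued_logz]
    have h1 := congrArg (D.gammaz z) h
    simp only [map_sum, gammaz_X_pow_smul, gammaz_logSection, map_zero] at h1
    rw [Finset.sum_range_succ, add_comm, ← eq_neg_iff_add_eq_zero] at h1
    have h2 : Valued.v (D.tz z.1 ^ (n + 1) * D.logz U (f (n + 1)) z) ≤
        Valued.v (D.tz z.1) ^ (n + 1) := by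
      rw [h1, Valuation.map_neg]
      refine Valuation.map_sum_le _ fun i hi => ?_
      rw [map_mul, map_pow]
      calc Valued.v (D.tz z.1) ^ i * Valued.v (D.logz U (f i) z)
          ≤ Valued.v (D.tz z.1) ^ i * Valued.v (D.tz z.1) := by
            gcongr
            exact D.logz_le U (f i) z
        _ = Valued.v (D.tz z.1) ^ (i + 1) := (pow_succ _ _).symm
        _ ≤ _ := pow_le_pow_right₀ (D.one_lt_valued_tz z.1).le (Finset.mem_range.mp hi)
    rw [map_mul, map_pow] at h2
    have hpos : 0 < Valued.v (D.tz z.1) ^ (n + 1) :=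
      pow_pos (zero_lt_one.trans (D.one_lt_valued_tz z.1)) _
    exact (mul_le_iff_le_one_right hpos).mp h2
  exact ⟨F, Subtype.ext hF⟩

/-- The map `O_X(∞) ⊗ A ⟶ C` on sections. -/
def projSections (U : D.X.Opens) : k[X] ⊗[k] D.OInftySections 1 U →ₗ[k[X]] D.CSections U :=
  PolynomialTensor.lift (D.logSection U) (D.logSection_smul U)

theorem projSections_tmul (U : D.X.Opens) (a : k[X]) (f : D.OInftySections 1 U) :
    D.projSections U (a ⊗ₜ f) = a • D.logSection U f :=
  PolynomialTensor.lift_tmul _ _ _ _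

theorem projSections_res {U V : D.X.Opens} (h : V ≤ U) :
    D.projSections V ∘ₗ (D.OInftyRes 1 h).baseChange k[X] = D.CRes h ∘ₗ D.projSections U := by
  refine TensorProduct.AlgebraTensorModule.ext fun a f => ?_
  exact (D.projSections_tmul V a (D.OInftyRes 1 h f)).trans
    ((congrArg (a • ·) (D.logSection_res h f)).trans
    (((D.CRes h).map_smul a (D.logSection U f)).symm.trans
    (congrArg (D.CRes h) (D.projSections_tmul U a f).symm)))

/-- The map `O_X(∞) ⊗ A ⟶ C` of presheaves. -/
def projPresheaf : D.OXInfty 1 ⋙ tensorA k ⟶ D.CPresheaf where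
  app U := ModuleCat.ofHom (D.projSections U.unop)
  naturality U V i := by
    refine ModuleCat.hom_ext ?_
    refine LinearMap.ext fun x => ?_
    change D.projSections V.unop ((D.OInftyRes 1 i.unop.le).baseChange k[X] x) =
      D.CRes i.unop.le (D.projSections U.unop x)
    exact LinearMap.congr_fun (D.projSections_res i.unop.le) x

theorem exact_boundarySections (U : D.X.Opens) :
    Function.Exact (D.boundarySections U) (D.projSections U) :=
  PolynomialTensor.exact_boundary (D.incl U) (D.carlitzO U) (D.logSection U)
    (D.logSection_smul U) (D.X_smul_logSection_incl U) (D.logSection_injective U)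
    (D.top_coeff_mem_range_incl U)

theorem boundarySections_injective (U : D.X.Opens) : Function.Injective (D.boundarySections U) :=
  PolynomialTensor.boundary_injective (D.incl_injective U) (D.carlitzO U)

/-! ### Local surjectivity onto `C`. -/

theorem CRes_rfl {U : D.X.Opens} (x : D.CSections U) : D.CRes le_rfl x = x :=
  Subtype.ext (Prod.ext (D.res_rfl x.1.1) rfl)

theorem CRes_CRes {U V W : D.X.Opens} (h : V ≤ U) (h' : W ≤ V) (x : D.CSections U) :
    D.CRes h' (D.CRes h x) = D.CRes (h'.trans h) x :=
  Subtype.ext (Prod.ext (D.res_res (inf_le_inf_right _ h) (inf_le_inf_right _ h') x.1.1) rfl)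

theorem gammaz_CRes {U V : D.X.Opens} (h : V ≤ U) (z : D.InftyIn V) (x : D.CSections U) :
    D.gammaz z (D.CRes h x) = D.gammaz ⟨z.1, h z.2⟩ x :=
  congrArg (Module.AEval'.of (LinearMap.mulLeft k (D.tz z.1))).symm (D.CRes_snd h x z)

/-- A section of `C` with small components at infinity is of the form `(f, log f)`. -/
theorem exists_logSection_eq {U : D.X.Opens} (x : D.CSections U)
    (hx : ∀ z : D.InftyIn U, Valued.v (D.gammaz z x) ≤ Valued.v (D.tz z.1)) :
    ∃ f, D.logSection U f = x := by
  have hexp : ∀ z : D.InftyIn U, HasCarlitzExp (Fintype.card k) (D.tz z.1) (D.gammaz z x)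
      (D.expand U z.1 z.2 ((Module.AEval'.of _).symm x.1.1)) := x.2
  have hf : (Module.AEval'.of _).symm x.1.1 ∈ D.OInftySections 1 U := by
    rw [mem_OInftySections_iff]
    intro z
    rw [CarlitzExp.valuation_eq Fintype.one_lt_card (D.one_lt_valued_tz z.1) (hx z) (hexp z)]
    exact hx z
  refine ⟨⟨_, hf⟩, Subtype.ext (Prod.ext ?_ (funext fun z => ?_))⟩
  · rw [logSection_fst]
    exact LinearEquiv.apply_symm_apply _ _
  · rw [logSection_snd, ← D.eq_logz (f := ⟨_, hf⟩) (hx z) (hexp z)]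
    exact LinearEquiv.apply_symm_apply _ _

theorem projSections_one_tmul (U : D.X.Opens) (f : D.OInftySections 1 U) :
    D.projSections U (1 ⊗ₜ f) = D.logSection U f :=
  (D.projSections_tmul U 1 f).trans (one_smul _ _)

theorem projSections_add_tmul_eq {U V W : D.X.Opens} (hVU : V ≤ U) (hWV : W ≤ V) (a : k[X])
    (x : D.CSections U) (x' : D.CSections V) (f : D.OInftySections 1 V)
    (hx' : x' + a • D.logSection V f = D.CRes hVU x) (s : k[X] ⊗[k] D.OInftySections 1 W)
    (hs : D.projSections W s = D.CRes hWV x') :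
    D.projSections W (s + a ⊗ₜ D.OInftyRes 1 hWV f) = D.CRes (hWV.trans hVU) x := by
  have h1 : D.projSections W (a ⊗ₜ D.OInftyRes 1 hWV f) = D.CRes hWV (a • D.logSection V f) :=
    (D.projSections_tmul W a _).trans ((congrArg (a • ·) (D.logSection_res hWV f)).trans
      ((D.CRes hWV).map_smul a (D.logSection V f)).symm)
  exact ((D.projSections W).map_add _ _).trans ((congrArg₂ (· + ·) hs h1).trans
    (((D.CRes hWV).map_add _ _).symm.trans ((congrArg (D.CRes hWV) hx').trans
      (D.CRes_CRes hVU hWV x))))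

/-- Near a point `z` above `∞`, multiples `t ^ n log f` with `f` in `O_X(∞)` approximate the
elements of `K_z` with a pole of order at most that of `t ^ (n + 1)`. -/
theorem exists_logz_approx {U : D.X.Opens} (z : D.InftyIn U) (n : ℕ) (γ : D.Kz z.1)
    (hU : ∀ w : D.Infty, w.1 ∈ U → w = z.1)
    (hγ : Valued.v γ ≤ Valued.v (D.tz z.1) ^ (n + 1)) :
    ∃ (V : D.X.Opens) (_ : V ≤ U) (hz : z.1.1 ∈ V) (f : D.OInftySections 1 V),
      Valued.v (γ - D.tz z.1 ^ n * D.logz V f ⟨z.1, hz⟩) ≤ Valued.v (D.tz z.1) ^ n := by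
  have ht := D.one_lt_valued_tz z.1
  have ht0 : 0 < Valued.v (D.tz z.1) := zero_lt_one.trans ht
  have htz : D.tz z.1 ≠ 0 := (Valuation.ne_zero_iff _).mp ht0.ne'
  obtain ⟨y, rfl⟩ : ∃ y : D.Kz z.1, γ = D.tz z.1 ^ n * y :=
    ⟨γ / D.tz z.1 ^ n, (mul_div_cancel₀ _ (pow_ne_zero _ htz)).symm⟩
  have hy : Valued.v y ≤ Valued.v (D.tz z.1) := by
    rw [map_mul, map_pow, pow_succ] at hγ
    exact le_of_mul_le_mul_left hγ (pow_pos ht0 n)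
  obtain ⟨V, hVU, hzV, f, hf1, hf2⟩ := D.exists_approx z y hy
  have hf : f ∈ D.OInftySections 1 V := by
    rw [mem_OInftySections_iff]
    rintro ⟨w, hw⟩
    -- The approximation controls `f` only at `z`; membership in `O_X(∞)` needs that `V` contains no
    -- other point above `∞`.
    obtain rfl := hU w (hVU hw)
    exact hf1
  refine ⟨V, hVU, hzV, ⟨f, hf⟩, ?_⟩
  -- Here `|f - log f| ≤ |t⁻¹ log f| ≤ 1`, so replacing `f` by its logarithm costs only an integral
  -- error, the same size as that of the approximation.
  have h1 := CarlitzExp.valuation_sub_le Fintype.one_lt_card ht (D.logz_le V ⟨f, hf⟩ ⟨z.1, hzV⟩)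
    (D.hasCarlitzExp_logz V ⟨f, hf⟩ ⟨z.1, hzV⟩)
  have h2 : Valued.v ((D.tz z.1)⁻¹ * D.logz V ⟨f, hf⟩ ⟨z.1, hzV⟩) ≤ 1 := by
    rw [map_mul, map_inv₀, inv_mul_le_iff₀ ht0, mul_one]
    exact D.logz_le V ⟨f, hf⟩ ⟨z.1, hzV⟩
  have h3 := Valuation.map_add_le Valued.v hf2 (h1.trans h2)
  rw [sub_add_sub_cancel] at h3
  rw [← mul_sub, map_mul, map_pow]
  exact mul_le_of_le_one_right' h3

set_option maxHeartbeats 1000000 in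
theorem exists_valued_sub_le {U : D.X.Opens} (z : D.InftyIn U) (n : ℕ) (x : D.CSections U)
    (hU : ∀ w : D.Infty, w.1 ∈ U → w = z.1)
    (hx : Valued.v (D.gammaz z x) ≤ Valued.v (D.tz z.1) ^ (n + 1)) :
    ∃ (V : D.X.Opens) (hVU : V ≤ U) (hz : z.1.1 ∈ V) (F : D.OInftySections 1 V)
      (x' : D.CSections V), x' + (Polynomial.X : k[X]) ^ n • D.logSection V F = D.CRes hVU x ∧
        Valued.v (D.gammaz ⟨z.1, hz⟩ x') ≤ Valued.v (D.tz z.1) ^ n := by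
  obtain ⟨V, hVU, hzV, F, hF⟩ := D.exists_logz_approx z n (D.gammaz z x) hU hx
  obtain ⟨x', hx'⟩ : ∃ x' : D.CSections V,
      x' + (Polynomial.X : k[X]) ^ n • D.logSection V F = D.CRes hVU x :=
    ⟨_, sub_add_cancel _ _⟩
  have h1 := ((D.gammaz ⟨z.1, hzV⟩).map_add _ _).symm.trans ((congrArg (D.gammaz _) hx').trans
    (D.gammaz_CRes hVU ⟨z.1, hzV⟩ x))
  have h2 := D.gammaz_X_pow_smul ⟨z.1, hzV⟩ n (D.logSection V F)
  have h3 := eq_sub_of_add_eq ((congrArg (D.gammaz ⟨z.1, hzV⟩ x' + ·) h2.symm).trans h1)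
  exact ⟨V, hVU, hzV, F, x', hx', (congrArg Valued.v h3).trans_le hF⟩

-- Induction on the pole order of `γ_z`: each step shrinks the neighbourhood and removes a multiple
-- `X ^ n • log F`, replacing the bound `|t| ^ (n + 1)` by `|t| ^ n`. At `n = 0` the component lies
-- in the disc, where the section is `(f, log f)`.
set_option maxHeartbeats 1000000 in
theorem exists_projSections_eq (z : D.Infty) (n : ℕ) (U : D.X.Opens) (hz : z.1 ∈ U)
    (hU : ∀ w : D.Infty, w.1 ∈ U → w = z) (x : D.CSections U)
    (hx : Valued.v (D.gammaz ⟨z, hz⟩ x) ≤ Valued.v (D.tz z) ^ (n + 1)) :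
    ∃ (V : D.X.Opens) (h : V ≤ U), z.1 ∈ V ∧ ∃ s, D.projSections V s = D.CRes h x := by
  induction n generalizing U with
  | zero =>
    rw [zero_add, pow_one] at hx
    have hx' : ∀ w : D.InftyIn U, Valued.v (D.gammaz w x) ≤ Valued.v (D.tz w.1) := by
      rintro ⟨w, hw⟩
      obtain rfl := hU w hw
      exact hx
    obtain ⟨f, hf⟩ := D.exists_logSection_eq x hx'
    exact ⟨U, le_rfl, hz, 1 ⊗ₜ f,
      (D.projSections_one_tmul U f).trans (hf.trans (D.CRes_rfl x).symm)⟩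
  | succ n ih =>
    obtain ⟨V, hVU, hzV, F, x', hx', hF⟩ := D.exists_valued_sub_le ⟨z, hz⟩ (n + 1) x hU hx
    obtain ⟨W, hWV, hzW, s, hs⟩ := ih V hzV (fun w hw => hU w (hVU hw)) x' hF
    exact ⟨W, hWV.trans hVU, hzW, _, D.projSections_add_tmul_eq hVU hWV _ x x' F hx' s hs⟩

set_option maxHeartbeats 1000000 in
theorem exists_local_lift {U : D.X.Opens} (x : D.CSections U) (p : D.X) (hp : p ∈ U) :
    ∃ (V : D.X.Opens) (h : V ≤ U), p ∈ V ∧ ∃ s, D.projSections V s = D.CRes h x := by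
  by_cases hpY : p ∈ D.Y
  · obtain ⟨f, hf⟩ := D.exists_logSection_eq (D.CRes (inf_le_left : U ⊓ D.Y ≤ U) x)
      fun z => (z.1.2 z.2.2).elim
    exact ⟨U ⊓ D.Y, inf_le_left, ⟨hp, hpY⟩, 1 ⊗ₜ f, (D.projSections_one_tmul _ f).trans hf⟩
  · obtain ⟨W, hzW, hW⟩ := D.exists_nhd_infty ⟨p, hpY⟩
    have hzU : p ∈ U ⊓ W := ⟨hp, hzW⟩
    have ht := D.one_lt_valued_tz ⟨p, hpY⟩
    -- The value group is archimedean and `|t| > 1`, so `γ_z` has some pole order bound from which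
    -- the induction can start.
    obtain ⟨n, hn⟩ := MulArchimedean.arch (Valued.v (D.gammaz ⟨⟨p, hpY⟩, hzU⟩
      (D.CRes (inf_le_left : U ⊓ W ≤ U) x))) ht
    obtain ⟨V, hV, hzV, s, hs⟩ := D.exists_projSections_eq ⟨p, hpY⟩ n (U ⊓ W) hzU
      (fun w hw => hW w hw.2) _ (hn.trans (pow_le_pow_right₀ ht.le n.le_succ))
    exact ⟨V, hV.trans inf_le_left, hzV, s, hs.trans (D.CRes_CRes inf_le_left hV x)⟩

theorem isLocallySurjective_projPresheaf :
    TopCat.Presheaf.IsLocallySurjective D.projPresheaf := by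
  rw [TopCat.Presheaf.isLocallySurjective_iff]
  intro U x p hp
  obtain ⟨V, h, hpV, s, hs⟩ := D.exists_local_lift x p hp
  exact ⟨V, h, ⟨s, hs⟩, hpV⟩

end CurveOverP1

end

/-! ### The short exact sequence of sheaves. -/

theorem theorem1 (k : Type u) [Field k] [Fintype k] (D : CurveOverP1 k) :
    ∃ (π : D.sheafTensor (D.OXInfty 1) ⟶ D.C) (w : D.boundary ≫ π = 0),
      (ShortComplex.mk D.boundary π w).ShortExact := by
  exact Presheaf.exists_shortExact_presheafToSheaf (Opens.grothendieckTopology D.X) D.C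
    D.boundaryPresheaf D.projPresheaf (fun U => D.boundarySections_injective U.unop)
    (fun U => D.exact_boundarySections U.unop) D.isLocallySurjective_projPresheaf
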